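/- Let $\lambda$ be a strongly inaccessible Mahlo cardinal, let $S\subseteq\{\mu<\lambda:\mu\text{ is a strongly inaccessible cardinal}\}$ be stationary in $\lambda$, let $S_0\subseteq\lambda$ be a set of limit ordinals, and assume that for every $\mu\in S$ the diamond principle $\diamondsuit_{S_0\cap\mu}$ holds: there are $\nu_\delta\in{}^{\delta}2$ ($\delta\in S_0\cap\mu$) such that for every $\nu\in{}^{\mu}2$ the set $\{\delta\in S_0\cap\mu:\nu{\restriction}\delta=\nu_\delta\}$ is stationary in $\mu$. For a limit ordinal $\alpha>0$, an $\alpha$-tree is a set $T\subseteq{}^{\alpha>}2$ of $0$-$1$ sequences of length less than $\alpha$ such that (i) $\langle\rangle\in T$ and $T$ is closed under initial segments; (ii) if $\eta\in T$ then $\eta^\frown\langle0\rangle,\eta^\frown\langle1\rangle\in T$; (iii) for every $\eta\in T$ and $\beta<\alpha$ with $\mathrm{lg}(\eta)\le\beta$ there is $\nu\in T$ extending $\eta$ with $\mathrm{lg}(\nu)=\beta$. For a limit ordinal $0<\delta\le\alpha$ let $\lim_\delta(T)=\{\eta\in{}^{\delta}2:(\forall\beta<\delta)\ \eta{\restriction}\beta\in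 T\}$. The $\alpha$-tree $T$ has true height $\alpha$ if every $\eta\in T$ is an initial segment of some element of $\lim_\alpha(T)$. A $\lambda$-Souslin tree is a $\lambda$-tree ($\lambda$ a cardinal) in which every antichain, i.e. every set of pairwise incomparable elements, has size less than $\lambda$. Let $\mathbb{Q}$ be the forcing notion whose conditions are the $\alpha$-trees $T$ of true height $\alpha$, for limit ordinals $\alpha=\alpha(T)<\lambda$, such that $\lim_\delta(T)\setminus T$ has at most one element for every limit ordinal $\delta<\alpha$, ordered by end-extension: $T_2$ is stronger than $T_1$ if and only if $T_1=T_2\cap{}^{\alpha(T_1)>}2$. Let $\dot{\mathbf T}$ be the canonical $\mathbb{Q}$-name for the union of all trees in the generic filter. Then $$\Vdash_{\mathbb{Q}}\ \text{``}\dot{\mathbf T}\text{ is a }\lambda\text{-Souslin tree''}.$$ -/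

import Mathlib

universe u v

/-! ### Stationary sets of ordinals, Mahlo cardinals -/

/-- `A ∩ o` is a stationary subset of the ordinal `o`: it meets every closed unbounded
subset of `o`. -/
def StationaryIn (o : Ordinal.{u}) (A : Set Ordinal.{u}) : Prop :=
  IsStationary {x : Set.Iio o | (x : Ordinal.{u}) ∈ A}

/-- `lam` is a (strongly inaccessible) Mahlo cardinal. -/
def IsMahloCardinal (lam : Cardinal.{u}) : Prop :=
  lam.IsInaccessible ∧
    StationaryIn lam.ord {o | ∃ m : Cardinal.{u}, m.IsInaccessible ∧ o = m.ord}

/-! ### Transfinite 0-1 sequences and trees of such sequences -/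

/-- A sequence of zeros and ones whose length is an ordinal. Only the values `val ξ` for `ξ < len`
carry information; beyond `len` the function `val` is normalised to be `false`, so that two
sequences are equal exactly if they have the same length and the same entries. -/
@[ext]
structure BinSeq : Type (u + 1) where
  len : Ordinal.{u}
  val : Ordinal.{u} → Bool
  val_of_le : ∀ ξ, len ≤ ξ → val ξ = false

namespace BinSeq

/-- The empty sequence. -/
def nil : BinSeq.{u} where
  len := 0
  val _ := false
  val_of_le _ _ := rfl

open Classical in
/-- The restriction of `s` to `β` (it is `s` itself if `β` is at least the length of `s`). -/
noncomputable def restrict (s : BinSeq.{u}) (β : Ordinal.{u}) : BinSeq.{u} where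
  len := min s.len β
  val ξ := if ξ < β then s.val ξ else false
  val_of_le ξ h := by
    split_ifs with hξ
    · rcases min_le_iff.1 h with h | h
      · exact s.val_of_le ξ h
      · exact absurd hξ (not_lt.2 h)
    · rfl

open Classical in
/-- The sequence `s` followed by the single entry `b`. -/
noncomputable def snoc (s : BinSeq.{u}) (b : Bool) : BinSeq.{u} where
  len := Order.succ s.len
  val ξ := if ξ = s.len then b else s.val ξ
  val_of_le ξ h := by
    have h' : s.len < ξ := Order.succ_le_iff.1 h
    rw [if_neg h'.ne']
    exact s.val_of_le ξ h'.le

/-- `s` is an initial segment (not necessarily proper) of `t`. -/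
def IsInit (s t : BinSeq.{u}) : Prop :=
  s.len ≤ t.len ∧ ∀ ξ < s.len, s.val ξ = t.val ξ

end BinSeq

/-- `T` is an `α`-tree: `α` is a limit ordinal and `T` is a set of 0-1 sequences of length less
than `α` which contains the empty sequence, is closed under initial segments and under one-step
extensions, and in which every element has extensions of all lengths below `α`. -/
structure IsOrdTree (α : Ordinal.{u}) (T : Set BinSeq.{u}) : Prop where
  limit : Order.IsSuccLimit α
  len_lt : ∀ s ∈ T, s.len < α
  nil_mem : BinSeq.nil ∈ T
  init_mem : ∀ s t : BinSeq.{u}, t ∈ T → s.IsInit t → s ∈ T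
  snoc_mem : ∀ s ∈ T, ∀ b : Bool, s.snoc b ∈ T
  exists_ext : ∀ s ∈ T, ∀ β < α, s.len ≤ β → ∃ t ∈ T, s.IsInit t ∧ t.len = β

/-- The set of the sequences of length `δ` all of whose proper initial segments lie in `T`. -/
def treeLim (T : Set BinSeq.{u}) (δ : Ordinal.{u}) : Set BinSeq.{u} :=
  {s | s.len = δ ∧ ∀ β < δ, s.restrict β ∈ T}

/-- `T` has true height `α`: every element of `T` lies on a branch of length `α` through `T`. -/
def HasTrueHeight (α : Ordinal.{u}) (T : Set BinSeq.{u}) : Prop :=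
  ∀ s ∈ T, ∃ t ∈ treeLim T α, s.IsInit t

/-- At every limit level `δ < α` at most one branch of `T` below `δ` is not continued in `T`. -/
def IsFullBelow (α : Ordinal.{u}) (T : Set BinSeq.{u}) : Prop :=
  ∀ δ < α, Order.IsSuccLimit δ → (treeLim T δ \ T).Subsingleton

/-- The diamond principle on `E ∩ μ`: there are `ν_δ` of length `δ`, for `δ` in `E ∩ μ`, such that
every 0-1 sequence of length `μ` is guessed correctly at stationarily many `δ` in `E ∩ μ`. -/
def Diamond (E : Set Ordinal.{u}) (μ : Ordinal.{u}) : Prop :=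
  ∃ ν : Ordinal.{u} → BinSeq.{u}, (∀ δ ∈ E, δ < μ → (ν δ).len = δ) ∧
    ∀ x : BinSeq.{u}, x.len = μ → StationaryIn μ {δ | δ ∈ E ∧ x.restrict δ = ν δ}

/-! ### The forcing notion of trees -/

/-- The conditions: trees of true height `height < lam` with at most one missing branch at each
limit level. -/
@[ext]
structure TreeCond (lam : Cardinal.{u}) : Type (u + 1) where
  height : Ordinal.{u}
  carrier : Set BinSeq.{u}
  height_lt : height < lam.ord
  isTree : IsOrdTree height carrier
  trueHeight : HasTrueHeight height carrier
  full : IsFullBelow height carrier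

namespace TreeCond

theorem height_le_of_subset {lam : Cardinal.{u}} {T₁ T₂ : TreeCond lam}
    (h : T₁.carrier ⊆ T₂.carrier) : T₁.height ≤ T₂.height := by
  by_contra hlt
  obtain ⟨t, ht, -, hlen⟩ := T₁.isTree.exists_ext _ T₁.isTree.nil_mem T₂.height
    (not_le.1 hlt) (by simp [BinSeq.nil])
  exact (T₂.isTree.len_lt t (h ht)).ne hlen

/-- End-extension; the larger condition is the stronger one. -/
instance (lam : Cardinal.{u}) : Preorder (TreeCond lam) where
  le T₁ T₂ := T₁.carrier = {s | s ∈ T₂.carrier ∧ s.len < T₁.height}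
  le_refl T := by
    ext s
    exact ⟨fun h => ⟨h, T.isTree.len_lt s h⟩, fun h => h.1⟩
  le_trans T₁ T₂ T₃ h₁ h₂ := by
    have hle : T₁.height ≤ T₂.height :=
      height_le_of_subset (fun s hs => by rw [h₁] at hs; exact hs.1)
    ext s
    constructor
    · intro hs
      have h := hs
      rw [h₁] at h
      have h' := h.1
      rw [h₂] at h'
      exact ⟨h'.1, h.2⟩
    · intro hs
      rw [h₁]
      refine ⟨?_, hs.2⟩
      rw [h₂]
      exact ⟨hs.1, hs.2.trans_le hle⟩

end TreeCond

theorem small_binSeq_lt (o : Ordinal.{u}) : Small.{u} {s : BinSeq.{u} // s.len < o} := by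
  let f : {s : BinSeq.{u} // s.len < o} → Set.Iio o × (Set.Iio o → Bool) :=
    fun s => (⟨s.1.len, s.2⟩, fun ξ => s.1.val ξ)
  refine small_of_injective (f := f) ?_
  rintro ⟨s, hs⟩ ⟨t, ht⟩ h
  have h₁ : s.len = t.len := congrArg (fun x => (x.1 : Ordinal.{u})) h
  have h₂ : (fun ξ : Set.Iio o => s.val ξ) = fun ξ : Set.Iio o => t.val ξ := congrArg (fun x => x.2) h
  apply Subtype.ext
  apply BinSeq.ext h₁
  funext ξ
  rcases lt_or_ge ξ o with hξ | hξ
  · exact congrFun h₂ ⟨ξ, hξ⟩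
  · rw [s.val_of_le ξ (hs.le.trans hξ), t.val_of_le ξ (ht.le.trans hξ)]

/-- The forcing notion is a set. -/
instance (lam : Cardinal.{u}) : Small.{u} (TreeCond lam) := by
  have := small_binSeq_lt lam.ord
  let f : TreeCond lam → Set {s : BinSeq.{u} // s.len < lam.ord} :=
    fun T => {s | s.1 ∈ T.carrier}
  refine small_of_injective (f := f) ?_
  intro T₁ T₂ h
  have hc : T₁.carrier = T₂.carrier := by
    ext s
    have hs : ∀ hl : s.len < lam.ord, s ∈ T₁.carrier ↔ s ∈ T₂.carrier := fun hl =>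
      Set.ext_iff.1 h ⟨s, hl⟩
    exact ⟨fun h1 => (hs ((T₁.isTree.len_lt s h1).trans T₁.height_lt)).1 h1,
      fun h2 => (hs ((T₂.isTree.len_lt s h2).trans T₂.height_lt)).2 h2⟩
  exact TreeCond.ext (le_antisymm (TreeCond.height_le_of_subset hc.subset)
    (TreeCond.height_le_of_subset hc.symm.subset)) hc

instance (lam : Cardinal.{u}) :
    Small.{u} {x : TreeCond lam × BinSeq.{u} // x.2 ∈ x.1.carrier} := by
  have := small_binSeq_lt lam.ord
  let f : {x : TreeCond lam × BinSeq.{u} // x.2 ∈ x.1.carrier} →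
      TreeCond lam × {s : BinSeq.{u} // s.len < lam.ord} :=
    fun x => (x.1.1, ⟨x.1.2, (x.1.1.isTree.len_lt _ x.2).trans x.1.1.height_lt⟩)
  refine small_of_injective (f := f) ?_
  rintro ⟨⟨T, s⟩, hs⟩ ⟨⟨T', s'⟩, hs'⟩ h
  have h₁ : T = T' := congrArg (fun x => x.1) h
  have h₂ : s = s' := congrArg (fun x => x.2.1) h
  subst h₁
  subst h₂
  rfl

/-! ### Names and the forcing relation

The ground model is the universe `PSet.{u}` of sets. A forcing notion is a preorder `P` which is a
set (`Small.{u} P`), and in which larger conditions are stronger. -/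

/-- `P`-names: a name is a set of pairs consisting of a name and a condition. -/
inductive PName (P : Type v) : Type (max (u + 1) v)
  | mk (ι : Type u) (elt : ι → PName P) (cond : ι → P) : PName P

namespace PName

variable {P : Type v}

/-- The name consisting of the pairs `(elt i, cond i)`, for `i` in a small type. -/
noncomputable def ofSmall {ι : Type*} [Small.{u} ι] (elt : ι → PName.{u, v} P) (cond : ι → P) :
    PName.{u, v} P :=
  mk (Shrink.{u} ι) (fun i => elt ((equivShrink ι).symm i)) (fun i => cond ((equivShrink ι).symm i))

/-- The canonical name of a set `x` of the ground model: the set of all pairs `(check y, p)` with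
`y ∈ x` and `p` a condition. -/
noncomputable def check [Small.{u} P] : PSet.{u} → PName.{u, v} P
  | ⟨α, A⟩ => mk (α × Shrink.{u} P) (fun i => check (A i.1))
      (fun i => (equivShrink P).symm i.2)

/-- A name for the unordered pair `{x, y}`. -/
noncomputable def upair [Small.{u} P] (x y : PName.{u, v} P) : PName.{u, v} P :=
  ofSmall (ι := Bool × P) (fun i => if i.1 then x else y) (fun i => i.2)

/-- A name for the Kuratowski ordered pair `(x, y) = {{x}, {x, y}}`. -/
noncomputable def opair [Small.{u} P] (x y : PName.{u, v} P) : PName.{u, v} P :=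
  upair (upair x x) (upair x y)

end PName

/-- A statement of the forcing language, given by the set of the conditions that force it:
`φ p` says that `p` forces `φ`. -/
abbrev FStmt (P : Type v) : Type v := P → Prop

namespace FStmt

variable {P : Type v} [Preorder P]

/-- `p` forces `x = y` iff for every pair `(z, s)` in the name `x` every condition above `p` and
`s` forces `z ∈ y`, and symmetrically (with the definition of `p` forces `z ∈ y`, which is
`FStmt.mem` below, written out). -/
def eq : PName.{u, v} P → PName.{u, v} P → FStmt P
  | .mk ι A a, .mk κ B b => fun p =>
    (∀ i : ι, ∀ q, p ≤ q → a i ≤ q →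
      ∀ q', q ≤ q' → ∃ r, q' ≤ r ∧ ∃ j : κ, b j ≤ r ∧ eq (A i) (B j) r) ∧
    (∀ j : κ, ∀ q, p ≤ q → b j ≤ q →
      ∀ q', q ≤ q' → ∃ r, q' ≤ r ∧ ∃ i : ι, a i ≤ r ∧ eq (A i) (B j) r)

/-- `p` forces `x ∈ y` iff the conditions `r` such that `b ≤ r` and `r` forces `x = z`, for
some pair `(z, b)` in the name `y`, are dense above `p`. -/
def mem (x : PName.{u, v} P) : PName.{u, v} P → FStmt P
  | .mk κ B b => fun p => ∀ q, p ≤ q → ∃ r, q ≤ r ∧ ∃ j : κ, b j ≤ r ∧ eq x (B j) r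

/-- `p` forces `¬ φ` iff no condition above `p` forces `φ`. -/
def not (φ : FStmt P) : FStmt P := fun p => ∀ q, p ≤ q → ¬ φ q

def and (φ ψ : FStmt P) : FStmt P := fun p => φ p ∧ ψ p

def or (φ ψ : FStmt P) : FStmt P := fun p => ∀ q, p ≤ q → ∃ r, q ≤ r ∧ (φ r ∨ ψ r)

/-- `p` forces `φ → ψ` iff no condition above `p` forces both `φ` and `¬ ψ`. -/
def imp (φ ψ : FStmt P) : FStmt P := fun p => ∀ q, p ≤ q → φ q → ∃ r, q ≤ r ∧ ψ r

/-- The quantifiers range over all names. -/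
def all (Φ : PName.{u, v} P → FStmt P) : FStmt P := fun p => ∀ x, Φ x p

def ex (Φ : PName.{u, v} P → FStmt P) : FStmt P := fun p => ∀ q, p ≤ q → ∃ r, q ≤ r ∧ ∃ x, Φ x r

infixr:35 " ∧ᶠ " => FStmt.and
infixr:30 " ∨ᶠ " => FStmt.or
infixr:25 " →ᶠ " => FStmt.imp

def iff (φ ψ : FStmt P) : FStmt P := (φ →ᶠ ψ) ∧ᶠ (ψ →ᶠ φ)

/-- `∀ x ∈ a, Φ x`. -/
def allIn (a : PName.{u, v} P) (Φ : PName.{u, v} P → FStmt P) : FStmt P :=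
  all fun x => mem x a →ᶠ Φ x

/-- `∃ x ∈ a, Φ x`. -/
def exIn (a : PName.{u, v} P) (Φ : PName.{u, v} P → FStmt P) : FStmt P :=
  ex fun x => mem x a ∧ᶠ Φ x

/-- The statement is forced by every condition. -/
def Forced (φ : FStmt P) : Prop := ∀ p, φ p

/-! Set-theoretic notions, as statements of the forcing language. -/

/-- `x ⊆ y`. -/
def sub (x y : PName.{u, v} P) : FStmt P := allIn x fun z => mem z y

variable [Small.{u} P]

/-- `f` is a function from `a` to `b`. -/
def isFun (f a b : PName.{u, v} P) : FStmt P :=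
  (allIn f fun z => exIn a fun x => exIn b fun y => eq z (.opair x y)) ∧ᶠ
  (allIn a fun x => exIn b fun y => mem (.opair x y) f) ∧ᶠ
  (allIn a fun x => allIn b fun y => allIn b fun y' =>
    mem (.opair x y) f →ᶠ mem (.opair x y') f →ᶠ eq y y')

/-- `f` is an injective function from `a` to `b`. -/
def isInj (f a b : PName.{u, v} P) : FStmt P :=
  isFun f a b ∧ᶠ
  (allIn a fun x => allIn a fun x' => allIn b fun y =>
    mem (.opair x y) f →ᶠ mem (.opair x' y) f →ᶠ eq x x')

/-- `l` is a limit ordinal (and not zero): a nonempty transitive set of transitive sets without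
a largest element. -/
def isLimitOrd (l : PName.{u, v} P) : FStmt P :=
  (allIn l fun x => sub x l) ∧ᶠ
  (allIn l fun x => allIn x fun y => sub y x) ∧ᶠ
  (ex fun x => mem x l) ∧ᶠ
  (allIn l fun x => exIn l fun y => mem x y)

/-- The limit ordinal `l` is a cardinal: it has no injection into a smaller ordinal. -/
def isLimitCard (l : PName.{u, v} P) : FStmt P :=
  isLimitOrd l ∧ᶠ (allIn l fun β => not (ex fun f => isInj f l β))

/-- The cardinality of `A` is less than `l`: `A` can be injected into an element of `l`. -/
def cardLt (A l : PName.{u, v} P) : FStmt P :=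
  exIn l fun β => ex fun f => isInj f A β

/-- A name for the set `2 = {0, 1}`. -/
noncomputable def two : PName.{u, v} P := .check (2 : Ordinal.{u}).toPSet

/-- `s` is a 0-1 sequence of length `α`. -/
noncomputable def isSeq (s α : PName.{u, v} P) : FStmt P := isFun s α two

/-- `T` is an `l`-tree of 0-1 sequences. -/
noncomputable def isOrdTree (T l : PName.{u, v} P) : FStmt P :=
  isLimitOrd l ∧ᶠ
  -- the elements are 0-1 sequences of length less than `l`
  (allIn T fun s => exIn l fun α => isSeq s α) ∧ᶠ
  -- the empty sequence belongs to `T`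
  mem (.check ∅) T ∧ᶠ
  -- initial segments
  (allIn T fun t => allIn l fun α => all fun s => isSeq s α →ᶠ sub s t →ᶠ mem s T) ∧ᶠ
  -- one-step extensions
  (allIn T fun s => allIn l fun α => isSeq s α →ᶠ allIn two fun i => exIn T fun t =>
    all fun z => iff (mem z t) (mem z s ∨ᶠ eq z (.opair α i))) ∧ᶠ
  -- extensions of all lengths below `l`
  (allIn T fun s => allIn l fun α => isSeq s α →ᶠ allIn l fun β => sub α β →ᶠ
    exIn T fun t => sub s t ∧ᶠ isSeq t β)

/-- `A` is an antichain of the tree `T`: its distinct elements are incomparable in the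
initial segment order. -/
def isAntichain (A T : PName.{u, v} P) : FStmt P :=
  sub A T ∧ᶠ (allIn A fun x => allIn A fun y => sub x y →ᶠ eq x y)

/-- `l` is a cardinal and `T` is an `l`-Souslin tree: an `l`-tree in which every antichain has
size less than `l`. -/
noncomputable def isSouslinTree (T l : PName.{u, v} P) : FStmt P :=
  isLimitCard l ∧ᶠ isOrdTree T l ∧ᶠ (all fun A => isAntichain A T →ᶠ cardLt A l)

end FStmt

/-! ### The generic tree -/

/-- The 0-1 sequence `s` as a set of the ground model: the set of the ordered pairs `(ξ, s ξ)`
for `ξ` less than the length of `s`. -/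
noncomputable def BinSeq.toPSet (s : BinSeq.{u}) : PSet.{u} :=
  PSet.mk s.len.ToType fun a =>
    let ξ : PSet.{u} := (a : Ordinal.{u}).toPSet
    let i : PSet.{u} := (if s.val (a : Ordinal.{u}) then (1 : Ordinal.{u}) else 0).toPSet
    {{ξ}, {ξ, i}}

/-- The canonical name for the union of all trees in the generic filter: the set of all pairs
`(check s, T)` with `T` a condition and `s ∈ T`. -/
noncomputable def genericTree (lam : Cardinal.{u}) : PName.{u, u + 1} (TreeCond lam) :=
  PName.ofSmall (ι := {x : TreeCond lam × BinSeq.{u} // x.2 ∈ x.1.carrier})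
    (fun x => PName.check x.1.2.toPSet) (fun x => x.1.1)

/-! The union of a chain of conditions may fail to have true height, so the forcing is not obviously
closed. The remedy is to attach to every node a cofinal branch (`BranchedCond`) and to continue the
chosen branches at each later step; in the union they are again cofinal branches, so the limit is a
condition (`exists_isChainSup`). Such a chain, with arbitrary extensions interpolated at each step,
can be run up to any `μ ∈ S` closed under the construction. Closed `μ` exist because `S` is
stationary and, `lam` being inaccessible, there are fewer than `lam` conditions of height below a
given ordinal (`exists_isClosed`). Handling one dense open set per step gives distributivity
(`exists_forall_of_dense`): fewer than `lam` dense open sets are met by a single condition. Hence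
`lam` stays a cardinal, and conditions of arbitrarily large height are dense.

For the Souslin property let `A` name an antichain. Densely, a node extends to one that decides `A`:
either an element of `A` lies below it, or no element of `A` will ever be comparable with it
(`exists_decides`). Build a chain of length `μ ∈ S` routing every chosen branch through deciding
nodes, and at each limit stage omit the branch guessed by the diamond on `μ`, unless it is a chosen
one. A node `x` of level `μ` in any later condition is guessed correctly at some stage `δ` whose
tree has height `δ`. Since `x.restrict δ` was nevertheless kept, it is a chosen branch, so it passes
through a deciding node. Thus every node of level `μ` lies above a deciding node of level below `μ`
(`exists_sealed`). This confines `A` to sequences of length below `μ`, of which there are fewer than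
`lam`.

The transfer to the forcing language rests on the regularity of forced statements (`Reg`): to prove
one it suffices to pass to denser conditions, where the relevant names become canonical names of
ground model sequences and ordinals. -/

/-! ### Initial segments -/

namespace BinSeq

/-- Sequences are ordered by the initial segment relation. -/
instance : PartialOrder BinSeq.{u} where
  le := IsInit
  le_refl s := ⟨le_rfl, fun _ _ => rfl⟩
  le_trans s t r h₁ h₂ :=
    ⟨h₁.1.trans h₂.1, fun ξ hξ => (h₁.2 ξ hξ).trans (h₂.2 ξ (hξ.trans_le h₁.1))⟩
  le_antisymm s t h₁ h₂ := by
    have hl := le_antisymm h₁.1 h₂.1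
    refine BinSeq.ext hl (funext fun ξ => ?_)
    rcases lt_or_ge ξ s.len with hξ | hξ
    · exact h₁.2 ξ hξ
    · rw [s.val_of_le ξ hξ, t.val_of_le ξ (hl ▸ hξ)]

variable {s t r : BinSeq.{u}} {β γ : Ordinal.{u}}

theorem len_mono (h : s ≤ t) : s.len ≤ t.len := h.1

theorem eq_of_le_of_len_le (h : s ≤ t) (hl : t.len ≤ s.len) : s = t :=
  le_antisymm h ⟨hl, fun ξ hξ => (h.2 ξ (hξ.trans_le hl)).symm⟩

theorem le_of_le_of_le (hs : s ≤ r) (ht : t ≤ r) (hl : s.len ≤ t.len) : s ≤ t :=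
  ⟨hl, fun ξ hξ => (hs.2 ξ hξ).trans (ht.2 ξ (hξ.trans_le hl)).symm⟩

theorem restrict_len (s : BinSeq.{u}) (β : Ordinal.{u}) : (s.restrict β).len = min s.len β := rfl

theorem restrict_len_of_le (h : β ≤ s.len) : (s.restrict β).len = β := min_eq_right h

theorem restrict_val (h : γ < β) : (s.restrict β).val γ = s.val γ := if_pos h

theorem restrict_le (s : BinSeq.{u}) (β : Ordinal.{u}) : s.restrict β ≤ s :=
  ⟨min_le_left _ _, fun _ hξ => restrict_val (hξ.trans_le (min_le_right _ _))⟩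

theorem restrict_eq_of_le (h : s ≤ t) : t.restrict s.len = s :=
  (eq_of_le_of_len_le (le_of_le_of_le h (t.restrict_le _) (by rw [restrict_len_of_le h.1]))
    (by rw [restrict_len_of_le h.1])).symm

theorem restrict_of_len_le (h : s.len ≤ β) : s.restrict β = s :=
  eq_of_le_of_len_le (s.restrict_le β) (by rw [restrict_len, min_eq_left h])

theorem le_restrict (h : s ≤ t) (hl : s.len ≤ β) : s ≤ t.restrict β :=
  le_of_le_of_le h (t.restrict_le β) (le_min h.1 hl)

theorem restrict_eq_restrict_of_le (h : s ≤ t) (hl : β ≤ s.len) : s.restrict β = t.restrict β :=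
  eq_of_le_of_len_le (le_restrict ((s.restrict_le β).trans h) (min_le_right _ _))
    (by rw [restrict_len_of_le hl]; exact min_le_right _ _)

theorem restrict_restrict (h : β ≤ γ) : (s.restrict γ).restrict β = s.restrict β := by
  rcases le_total γ s.len with hl | hl
  · exact restrict_eq_restrict_of_le (s.restrict_le γ) (by rwa [restrict_len_of_le hl])
  · rw [restrict_of_len_le hl]

theorem le_snoc (s : BinSeq.{u}) (b : Bool) : s ≤ s.snoc b :=
  ⟨Order.le_succ _, fun _ h => (if_neg h.ne).symm⟩

/-- `s` continued by zeros up to length `β`. -/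
def pad (s : BinSeq.{u}) (β : Ordinal.{u}) (h : s.len ≤ β) : BinSeq.{u} :=
  ⟨β, s.val, fun ξ hξ => s.val_of_le ξ (h.trans hξ)⟩

theorem le_pad (h : s.len ≤ β) : s ≤ s.pad β h := ⟨h, fun _ _ => rfl⟩

end BinSeq

open BinSeq

/-! ### Trees and their limit levels. -/

variable {T U : Set BinSeq.{u}} {α δ : Ordinal.{u}}

theorem IsOrdTree.mem_of_le (h : IsOrdTree α T) {s t : BinSeq.{u}} (ht : t ∈ T) (hs : s ≤ t) :
    s ∈ T := h.init_mem s t ht hs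

theorem mem_of_lt_of_mem_treeLim {s t : BinSeq.{u}} (ht : t ∈ treeLim T δ) (hs : s ≤ t)
    (hl : s.len < δ) : s ∈ T := by
  have := ht.2 _ hl
  rwa [restrict_eq_of_le hs] at this

/-- A limit ordinal above `α` is closed under successor, so it exceeds every `α + n`. Hence adding
`ω` levels to a tree creates a single new limit level, the old height. -/
theorem add_omega0_le_of_isSuccLimit (hδ : Order.IsSuccLimit δ) (h : α < δ) :
    α + Ordinal.omega0 ≤ δ := by
  have hn : ∀ n : ℕ, α + n < δ := by
    intro n
    induction n with
    | zero => simpa using h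
    | succ n ih =>
      rw [Nat.cast_succ, ← add_assoc, ← Order.succ_eq_add_one]
      exact hδ.succ_lt ih
  by_contra hlt
  obtain ⟨γ, rfl⟩ := exists_add_of_le h.le
  obtain ⟨n, rfl⟩ := Ordinal.lt_omega0.1 (lt_of_add_lt_add_left (not_le.1 hlt))
  exact lt_irrefl _ (hn n)

/-! ### End-extension, and extension of a condition by `ω` levels. -/

namespace TreeCond

variable {lam : Cardinal.{u}} {T₁ T₂ L : TreeCond lam} {s t : BinSeq.{u}}

theorem mem_of_le (h : T₁ ≤ T₂) (hs : s ∈ T₁.carrier) : s ∈ T₂.carrier := by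
  have h' : T₁.carrier = {s | s ∈ T₂.carrier ∧ s.len < T₁.height} := h
  rw [h'] at hs
  exact hs.1

theorem mem_of_le_of_len_lt (h : T₁ ≤ T₂) (hs : s ∈ T₂.carrier) (hl : s.len < T₁.height) :
    s ∈ T₁.carrier := by
  have h' : T₁.carrier = {s | s ∈ T₂.carrier ∧ s.len < T₁.height} := h
  rw [h']
  exact ⟨hs, hl⟩

theorem le_of_forall (h₁ : ∀ s ∈ T₁.carrier, s ∈ T₂.carrier)
    (h₂ : ∀ s ∈ T₂.carrier, s.len < T₁.height → s ∈ T₁.carrier) : T₁ ≤ T₂ := by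
  change T₁.carrier = {s | s ∈ T₂.carrier ∧ s.len < T₁.height}
  ext s
  exact ⟨fun h => ⟨h₁ s h, T₁.isTree.len_lt s h⟩, fun h => h₂ s h.1 h.2⟩

theorem height_mono (h : T₁ ≤ T₂) : T₁.height ≤ T₂.height :=
  height_le_of_subset fun _ => mem_of_le h

theorem down_mem (ht : t ∈ T₁.carrier) (h : s ≤ t) : s ∈ T₁.carrier := T₁.isTree.mem_of_le ht h

/-- The nodes of the tree obtained from a tree of height `α` by putting the branches in `K` at
level `α` and all nodes above them at the next `ω` levels. -/
def extendSet (α : Ordinal.{u}) (T K : Set BinSeq.{u}) : Set BinSeq.{u} :=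
  {s | (s.len < α ∧ s ∈ T) ∨ (α ≤ s.len ∧ s.len < α + Ordinal.omega0 ∧ s.restrict α ∈ K)}

/-- The extension of a tree by `ω` further levels, keeping exactly the branches in `K` at the first
of them. -/
def extend (L : TreeCond lam) (K : Set BinSeq.{u}) (hK : K ⊆ treeLim L.carrier L.height)
    (hsub : (treeLim L.carrier L.height \ K).Subsingleton)
    (hdense : ∀ s ∈ L.carrier, ∃ k ∈ K, s ≤ k)
    (hlt : L.height + Ordinal.omega0 < lam.ord) : TreeCond lam := by
  have hpos : L.height < L.height + Ordinal.omega0 :=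
    lt_add_of_pos_right _ Ordinal.omega0_pos
  have hlim : Order.IsSuccLimit (L.height + Ordinal.omega0) :=
    Ordinal.isSuccLimit_add _ Ordinal.isSuccLimit_omega0
  have hinit : ∀ s t : BinSeq.{u}, t ∈ extendSet L.height L.carrier K → s ≤ t →
      s ∈ extendSet L.height L.carrier K := by
    rintro s t (⟨h₁, h₂⟩ | ⟨h₁, h₂, h₃⟩) hst
    · exact Or.inl ⟨hst.1.trans_lt h₁, L.down_mem h₂ hst⟩
    · rcases lt_or_ge s.len L.height with hs | hs
      · exact Or.inl ⟨hs, mem_of_lt_of_mem_treeLim (hK h₃) (le_restrict hst hs.le) hs⟩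
      · exact Or.inr ⟨hs, hst.1.trans_lt h₂, by rwa [restrict_eq_restrict_of_le hst hs]⟩
  have hup : ∀ s ∈ extendSet L.height L.carrier K, ∃ t ∈ extendSet L.height L.carrier K,
      s ≤ t ∧ t.len = max s.len L.height := by
    rintro s (⟨h₁, h₂⟩ | ⟨h₁, h₂, h₃⟩)
    · obtain ⟨k, hk, hsk⟩ := hdense s h₂
      have hkl := (hK hk).1
      exact ⟨k, Or.inr ⟨hkl.ge, hkl ▸ hpos, by rwa [restrict_of_len_le hkl.le]⟩, hsk,
        by rw [hkl, max_eq_right h₁.le]⟩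
    · exact ⟨s, Or.inr ⟨h₁, h₂, h₃⟩, le_rfl, (max_eq_left h₁).symm⟩
  refine ⟨L.height + Ordinal.omega0, extendSet L.height L.carrier K, hlt,
    ⟨hlim, ?_, ?_, hinit, ?_, ?_⟩, ?_, ?_⟩
  · rintro s (⟨h₁, h₂⟩ | ⟨h₁, h₂, h₃⟩)
    · exact h₁.trans hpos
    · exact h₂
  · exact Or.inl ⟨L.isTree.len_lt _ L.isTree.nil_mem, L.isTree.nil_mem⟩
  · rintro s (⟨h₁, h₂⟩ | ⟨h₁, h₂, h₃⟩) b
    · exact Or.inl ⟨L.isTree.limit.succ_lt h₁, L.isTree.snoc_mem s h₂ b⟩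
    · refine Or.inr ⟨h₁.trans (Order.le_succ _), hlim.succ_lt h₂, ?_⟩
      rwa [← restrict_eq_restrict_of_le (s.le_snoc b) h₁]
  · intro s hs β hβ hsβ
    rcases lt_or_ge β L.height with h | h
    · rcases hs with ⟨h₁, h₂⟩ | ⟨h₁, h₂, h₃⟩
      · obtain ⟨t, ht, hst, rfl⟩ := L.isTree.exists_ext s h₂ β h hsβ
        exact ⟨t, Or.inl ⟨h, ht⟩, hst, rfl⟩
      · exact absurd (h₁.trans hsβ) (not_le.2 h)
    -- At or above the old height, climb to a branch in `K` if necessary and then pad by zeros: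
    -- above `K` every continuation is a node.
    · obtain ⟨t, ht, hst, hl⟩ := hup s hs
      have hlt : L.height ≤ t.len := hl ▸ le_max_right _ _
      have htβ : t.len ≤ β := hl ▸ max_le hsβ h
      refine ⟨t.pad β htβ, Or.inr ⟨h, hβ, ?_⟩, hst.trans (le_pad htβ), rfl⟩
      rw [← restrict_eq_restrict_of_le (le_pad htβ) hlt]
      rcases ht with h' | h'
      · exact absurd h'.1 (not_lt.2 hlt)
      · exact h'.2.2
  · intro s hs
    obtain ⟨t, ht, hst, hl⟩ := hup s hs
    have hlt : L.height ≤ t.len := hl ▸ le_max_right _ _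
    have h' : t.len < L.height + Ordinal.omega0 ∧ t.restrict L.height ∈ K := by
      rcases ht with h' | h'
      · exact absurd h'.1 (not_lt.2 hlt)
      · exact h'.2
    refine ⟨t.pad _ h'.1.le, ⟨rfl, fun β hβ => ?_⟩, hst.trans (le_pad _)⟩
    rcases lt_or_ge β t.len with hβt | hβt
    · rw [← restrict_eq_restrict_of_le (le_pad _) hβt.le]
      exact hinit _ _ ht (restrict_le _ _)
    · have hl : ((t.pad _ h'.1.le).restrict β).len = β := restrict_len_of_le hβ.le
      refine Or.inr ⟨by rw [hl]; exact hlt.trans hβt, by rwa [hl], ?_⟩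
      rw [restrict_restrict (hlt.trans hβt), ← restrict_eq_restrict_of_le (le_pad _) hlt]
      exact h'.2
  · intro δ hδ hδlim
    have key : ∀ s ∈ treeLim (extendSet L.height L.carrier K) δ, δ ≤ L.height →
        s ∈ treeLim L.carrier δ := fun s hs hle => ⟨hs.1, fun β hβ => by
      have hl : (s.restrict β).len = β := restrict_len_of_le (hs.1 ▸ hβ.le)
      rcases hs.2 β hβ with h | h
      · exact h.2
      · rw [hl] at h
        exact absurd (hβ.trans_le hle) (not_lt.2 h.1)⟩
    -- Fullness is inherited below the old height, is `hsub` at the old height, and concerns no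
    -- further limit level.
    rcases lt_trichotomy δ L.height with h | rfl | h
    · rintro s ⟨hs, hs'⟩ t ⟨ht, ht'⟩
      exact L.full δ h hδlim
        ⟨key s hs h.le, fun h' => hs' (Or.inl ⟨hs.1 ▸ h, h'⟩)⟩
        ⟨key t ht h.le, fun h' => ht' (Or.inl ⟨ht.1 ▸ h, h'⟩)⟩
    · rintro s ⟨hs, hs'⟩ t ⟨ht, ht'⟩
      refine hsub ⟨key s hs le_rfl, fun h' => hs' (Or.inr ⟨hs.1.ge, hs.1 ▸ hδ, ?_⟩)⟩
        ⟨key t ht le_rfl, fun h' => ht' (Or.inr ⟨ht.1.ge, ht.1 ▸ hδ, ?_⟩)⟩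
      · rwa [restrict_of_len_le hs.1.le]
      · rwa [restrict_of_len_le ht.1.le]
    · exact absurd (add_omega0_le_of_isSuccLimit hδlim h) (not_le.2 hδ)

variable {K : Set BinSeq.{u}} {hK : K ⊆ treeLim L.carrier L.height}
  {hsub : (treeLim L.carrier L.height \ K).Subsingleton}
  {hdense : ∀ s ∈ L.carrier, ∃ k ∈ K, s ≤ k} {hlt : L.height + Ordinal.omega0 < lam.ord}

theorem height_lt_height_extend : L.height < (L.extend K hK hsub hdense hlt).height :=
  lt_add_of_pos_right _ Ordinal.omega0_pos

theorem le_extend : L ≤ L.extend K hK hsub hdense hlt := by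
  refine le_of_forall (fun s hs => Or.inl ⟨L.isTree.len_lt s hs, hs⟩) fun s hs hl => ?_
  rcases hs with h | h
  · exact h.2
  · exact absurd hl (not_lt.2 h.1)

theorem mem_extend_of_mem {k : BinSeq.{u}} (hk : k ∈ K) :
    k ∈ (L.extend K hK hsub hdense hlt).carrier :=
  Or.inr ⟨(hK hk).1.ge, (hK hk).1.trans_lt (lt_add_of_pos_right _ Ordinal.omega0_pos),
    by rwa [restrict_of_len_le (hK hk).1.le]⟩

theorem mem_of_mem_extend (hs : s ∈ (L.extend K hK hsub hdense hlt).carrier)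
    (hl : s.len = L.height) : s ∈ K := by
  rcases hs with h | h
  · exact absurd h.1 hl.not_lt
  · rw [← restrict_of_len_le hl.le]
    exact h.2.2

end TreeCond

/-! ### Trees with chosen cofinal branches -/

/-- A condition together with a choice of a cofinal branch through every node. -/
structure BranchedCond (lam : Cardinal.{u}) : Type (u + 1) where
  tree : TreeCond lam
  br : BinSeq.{u} → BinSeq.{u}
  br_mem : ∀ s ∈ tree.carrier, br s ∈ treeLim tree.carrier tree.height
  le_br : ∀ s ∈ tree.carrier, s ≤ br s

namespace BranchedCond

variable {lam : Cardinal.{u}}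

/-- End-extension such that the chosen branches are continued. -/
instance : Preorder (BranchedCond lam) where
  le σ τ := σ.tree ≤ τ.tree ∧ ∀ s ∈ σ.tree.carrier, σ.br s ≤ τ.br s
  le_refl σ := ⟨le_rfl, fun _ _ => le_rfl⟩
  le_trans _ _ _ h₁ h₂ := ⟨h₁.1.trans h₂.1, fun s hs =>
    (h₁.2 s hs).trans (h₂.2 s (TreeCond.mem_of_le h₁.1 hs))⟩

theorem br_len (σ : BranchedCond lam) {s : BinSeq.{u}} (hs : s ∈ σ.tree.carrier) :
    (σ.br s).len = σ.tree.height := (σ.br_mem s hs).1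

/-- `L` is an upper bound of `F` of the least possible height. -/
def IsChainSup (F : Set (BranchedCond lam)) (L : BranchedCond lam) : Prop :=
  (∀ σ ∈ F, σ ≤ L) ∧ IsLUB ((fun σ : BranchedCond lam => σ.tree.height) '' F) L.tree.height

theorem IsChainSup.exists_lt {F : Set (BranchedCond lam)} {L : BranchedCond lam}
    (h : IsChainSup F L) {β : Ordinal.{u}} (hβ : β < L.tree.height) :
    ∃ σ ∈ F, β < σ.tree.height := by
  obtain ⟨_, ⟨σ, hσ, rfl⟩, h', -⟩ := h.2.exists_between hβ
  exact ⟨σ, hσ, h'⟩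

theorem IsChainSup.exists_mem {F : Set (BranchedCond lam)} {L : BranchedCond lam}
    (h : IsChainSup F L) {s : BinSeq.{u}} (hs : s ∈ L.tree.carrier) :
    ∃ σ ∈ F, s ∈ σ.tree.carrier := by
  obtain ⟨σ, hσ, hl⟩ := h.exists_lt (L.tree.isTree.len_lt s hs)
  exact ⟨σ, hσ, TreeCond.mem_of_le_of_len_lt (h.1 σ hσ).1 hs hl⟩

-- Take the union of the trees. The branches chosen for a node `s` cohere along the chain, and their
-- union `b s` is cofinal in the union tree; this yields true height. Fullness at a level `δ` is
-- inherited from any member of height above `δ`, since such a member already contains all nodes of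
-- the union of length below its height.
open Classical in
theorem exists_isChainSup {F : Set (BranchedCond lam)} (hne : F.Nonempty)
    (hF : IsChain (· ≤ ·) F) {α : Ordinal.{u}}
    (hα : IsLUB ((fun σ : BranchedCond lam => σ.tree.height) '' F) α) (hlt : α < lam.ord) :
    ∃ L, IsChainSup F L ∧ L.tree.height = α := by
  let U : Set BinSeq.{u} := {s | ∃ σ ∈ F, s ∈ σ.tree.carrier}
  have hle : ∀ σ ∈ F, σ.tree.height ≤ α := fun σ hσ => hα.1 ⟨σ, hσ, rfl⟩
  have hex : ∀ β < α, ∃ σ ∈ F, β < σ.tree.height := fun β hβ => by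
    obtain ⟨_, ⟨σ, hσ, rfl⟩, h', -⟩ := hα.exists_between hβ
    exact ⟨σ, hσ, h'⟩
  have htot : ∀ σ ∈ F, ∀ τ ∈ F, σ ≤ τ ∨ τ ≤ σ := fun σ hσ τ hτ => hF.total hσ hτ
  have hmem : ∀ s ∈ U, ∀ τ ∈ F, s.len < τ.tree.height → s ∈ τ.tree.carrier := by
    rintro s ⟨σ, hσ, hs⟩ τ hτ hl
    rcases htot σ hσ τ hτ with h | h
    · exact TreeCond.mem_of_le h.1 hs
    · exact TreeCond.mem_of_le_of_len_lt h.1 hs hl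
  have hboth : ∀ s ∈ U, ∀ β < α, ∃ τ ∈ F, s ∈ τ.tree.carrier ∧ β < τ.tree.height := by
    rintro s ⟨σ, hσ, hs⟩ β hβ
    obtain ⟨τ, hτ, hl⟩ := hex β hβ
    rcases htot σ hσ τ hτ with h | h
    · exact ⟨τ, hτ, TreeCond.mem_of_le h.1 hs, hl⟩
    · exact ⟨σ, hσ, hs, hl.trans_le (TreeCond.height_mono h.1)⟩
  obtain ⟨σ₀, hσ₀⟩ := hne
  have hlim : Order.IsSuccLimit α := by
    refine ⟨fun h => ?_, Order.isSuccPrelimit_of_succ_lt fun β hβ => ?_⟩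
    · exact ((bot_le.trans_lt σ₀.tree.isTree.limit.bot_lt).trans_le (hle σ₀ hσ₀)).not_ge
        (h bot_le)
    · obtain ⟨σ, hσ, h⟩ := hex β hβ
      exact (σ.tree.isTree.limit.succ_lt h).trans_le (hle σ hσ)
  let b : BinSeq.{u} → BinSeq.{u} := fun s =>
    { len := α
      val := fun ξ => decide (∃ σ ∈ F, s ∈ σ.tree.carrier ∧ (σ.br s).val ξ = true)
      val_of_le := fun ξ hξ => by
        rw [decide_eq_false_iff_not]
        rintro ⟨σ, hσ, hs, h⟩
        rw [(σ.br s).val_of_le ξ (by rw [σ.br_len hs]; exact (hle σ hσ).trans hξ)] at h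
        exact Bool.false_ne_true h }
  have hb : ∀ σ ∈ F, ∀ s ∈ σ.tree.carrier, σ.br s ≤ b s := by
    intro σ hσ s hs
    refine ⟨by rw [σ.br_len hs]; exact hle σ hσ, fun ξ hξ => ?_⟩
    rw [σ.br_len hs] at hξ
    change _ = decide _
    rcases h : (σ.br s).val ξ with _ | _
    · refine (decide_eq_false ?_).symm
      rintro ⟨τ, hτ, hsτ, hv⟩
      have : (σ.br s).val ξ = (τ.br s).val ξ := by
        rcases htot σ hσ τ hτ with hl | hl
        · exact (hl.2 s hs).2 ξ (by rwa [σ.br_len hs])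
        -- The value at `ξ` is `true`, so `ξ` lies below the length of the shorter branch: beyond it
        -- all values are `false`.
        · refine ((hl.2 s hsτ).2 ξ (lt_of_not_ge fun hge => ?_)).symm
          rw [(τ.br s).val_of_le ξ hge] at hv
          exact Bool.false_ne_true hv
      rw [h, hv] at this
      exact Bool.false_ne_true this
    · exact (decide_eq_true ⟨σ, hσ, hs, h⟩).symm
  have hbU : ∀ s ∈ U, b s ∈ treeLim U α ∧ s ≤ b s := by
    intro s hs
    refine ⟨⟨rfl, fun β hβ => ?_⟩, ?_⟩
    · obtain ⟨τ, hτ, hsτ, hl⟩ := hboth s hs β hβ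
      refine ⟨τ, hτ, ?_⟩
      rw [← restrict_eq_restrict_of_le (hb τ hτ s hsτ) (by rw [τ.br_len hsτ]; exact hl.le)]
      exact (τ.br_mem s hsτ).2 β hl
    · obtain ⟨σ, hσ, hs⟩ := hs
      exact (σ.le_br s hs).trans (hb σ hσ s hs)
  let T : TreeCond lam :=
    { height := α
      carrier := U
      height_lt := hlt
      isTree :=
        { limit := hlim
          len_lt := fun s ⟨σ, hσ, hs⟩ => (σ.tree.isTree.len_lt s hs).trans_le (hle σ hσ)
          nil_mem := ⟨σ₀, hσ₀, σ₀.tree.isTree.nil_mem⟩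
          init_mem := fun s t ⟨σ, hσ, hs⟩ h => ⟨σ, hσ, σ.tree.isTree.init_mem s t hs h⟩
          snoc_mem := fun s ⟨σ, hσ, hs⟩ b => ⟨σ, hσ, σ.tree.isTree.snoc_mem s hs b⟩
          exists_ext := fun s hs β hβ hsβ => by
            obtain ⟨τ, hτ, hsτ, hl⟩ := hboth s hs β hβ
            obtain ⟨t, ht, h⟩ := τ.tree.isTree.exists_ext s hsτ β hl hsβ
            exact ⟨t, ⟨τ, hτ, ht⟩, h⟩ }
      trueHeight := fun s hs => ⟨b s, hbU s hs⟩
      full := fun δ hδ hδlim s ⟨hs, hs'⟩ t ⟨ht, ht'⟩ => by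
        obtain ⟨σ, hσ, hl⟩ := hex δ hδ
        have key : ∀ s ∈ treeLim U δ, s ∈ treeLim σ.tree.carrier δ := fun s hs =>
          ⟨hs.1, fun β hβ => hmem _ (hs.2 β hβ) σ hσ ((min_le_right _ _).trans_lt (hβ.trans hl))⟩
        exact σ.tree.full δ hl hδlim ⟨key s hs, fun h => hs' ⟨σ, hσ, h⟩⟩
          ⟨key t ht, fun h => ht' ⟨σ, hσ, h⟩⟩ }
  refine ⟨⟨T, b, fun s hs => (hbU s hs).1, fun s hs => (hbU s hs).2⟩,
    ⟨fun σ hσ => ⟨?_, ?_⟩, hα⟩, rfl⟩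
  · exact TreeCond.le_of_forall (fun s hs => ⟨σ, hσ, hs⟩) fun s hs hl => hmem s hs σ hσ hl
  · exact hb σ hσ

open Classical in
/-- A supremum of `F` if there is one, and `p` otherwise. -/
noncomputable def chainSup (p : BranchedCond lam) (F : Set (BranchedCond lam)) : BranchedCond lam :=
  if h : ∃ L, IsChainSup F L then h.choose else p

theorem isChainSup_chainSup {p : BranchedCond lam} {F : Set (BranchedCond lam)}
    (h : ∃ L, IsChainSup F L) : IsChainSup F (chainSup p F) := by
  rw [chainSup, dif_pos h]
  exact h.choose_spec

/-- The branches at the top level of `L` other than `ν`, together with the chosen ones. -/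
def kept (L : BranchedCond lam) (ν : BinSeq.{u}) : Set BinSeq.{u} :=
  {k | k ∈ treeLim L.tree.carrier L.tree.height ∧ (k = ν → ∃ s ∈ L.tree.carrier, k = L.br s)}

/-- The extension of `L` by `ω` levels omitting `ν`, unless `ν` is one of the chosen branches. -/
def omitBranch (hlam : ∀ o < lam.ord, o + Ordinal.omega0 < lam.ord) (L : BranchedCond lam)
    (ν : BinSeq.{u}) : TreeCond lam :=
  L.tree.extend (L.kept ν) (fun _ h => h.1)
    (fun s ⟨hs, hs'⟩ t ⟨ht, ht'⟩ => by
      have key : ∀ s ∈ treeLim L.tree.carrier L.tree.height, s ∉ L.kept ν → s = ν :=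
        fun s hs hs' => by
          by_contra h
          exact hs' ⟨hs, fun h' => absurd h' h⟩
      rw [key s hs hs', key t ht ht'])
    (fun s hs => ⟨L.br s, ⟨L.br_mem s hs, fun _ => ⟨s, hs, rfl⟩⟩, L.le_br s hs⟩)
    (hlam _ L.tree.height_lt)

end BranchedCond

/-- The data for building a chain of conditions: `next` extends the conditions, `branch` chooses
branches through them, and `guess δ` is to be omitted at level `δ`. -/
structure ChainData (lam : Cardinal.{u}) where
  add_omega0_lt : ∀ o < lam.ord, o + Ordinal.omega0 < lam.ord
  next : Ordinal.{u} → TreeCond lam → TreeCond lam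
  le_next : ∀ i T, T ≤ next i T
  branch : TreeCond lam → BinSeq.{u} → BinSeq.{u}
  branch_mem : ∀ (T : TreeCond lam), ∀ s ∈ T.carrier, branch T s ∈ treeLim T.carrier T.height
  le_branch : ∀ (T : TreeCond lam), ∀ s ∈ T.carrier, s ≤ branch T s
  guess : Ordinal.{u} → BinSeq.{u}
  start : TreeCond lam

/-! ### One step of the construction, and the transfinite chain. -/

namespace ChainData

open BranchedCond

variable {lam : Cardinal.{u}} (D : ChainData lam)

/-- The condition chosen above `L`. -/
def nextTree (i : Ordinal.{u}) (L : BranchedCond lam) : TreeCond lam :=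
  D.next i (L.omitBranch D.add_omega0_lt (D.guess L.tree.height))

theorem omitBranch_le_nextTree (i : Ordinal.{u}) (L : BranchedCond lam) :
    L.omitBranch D.add_omega0_lt (D.guess L.tree.height) ≤ D.nextTree i L := D.le_next _ _

theorem le_nextTree (i : Ordinal.{u}) (L : BranchedCond lam) : L.tree ≤ D.nextTree i L :=
  TreeCond.le_extend.trans (D.omitBranch_le_nextTree i L)

theorem height_lt_height_nextTree (i : Ordinal.{u}) (L : BranchedCond lam) :
    L.tree.height < (D.nextTree i L).height :=
  TreeCond.height_lt_height_extend.trans_le (TreeCond.height_mono (D.omitBranch_le_nextTree i L))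

/-- The reason for exempting chosen branches from omission in `kept`: they remain nodes even when
guessed, and so can be continued. -/
theorem br_mem_omitBranch (L : BranchedCond lam) {s : BinSeq.{u}} (hs : s ∈ L.tree.carrier) :
    L.br s ∈ (L.omitBranch D.add_omega0_lt (D.guess L.tree.height)).carrier :=
  TreeCond.mem_extend_of_mem ⟨L.br_mem s hs, fun _ => ⟨s, hs, rfl⟩⟩

theorem br_mem_nextTree (i : Ordinal.{u}) (L : BranchedCond lam) {s : BinSeq.{u}}
    (hs : s ∈ L.tree.carrier) : L.br s ∈ (D.nextTree i L).carrier :=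
  TreeCond.mem_of_le (D.omitBranch_le_nextTree i L) (D.br_mem_omitBranch L hs)

open Classical in
/-- One step of the construction. -/
noncomputable def step (i : Ordinal.{u}) (L : BranchedCond lam) : BranchedCond lam where
  tree := D.nextTree i L
  -- The branch of an old node is now itself a node, and the new branch is chosen through it; this
  -- makes chosen branches cohere. A new node starts a fresh branch.
  br s := D.branch (D.nextTree i L) (if s ∈ L.tree.carrier then L.br s else s)
  br_mem s hs := by
    refine D.branch_mem _ _ ?_
    split_ifs with h
    · exact D.br_mem_nextTree i L h
    · exact hs
  le_br s hs := by
    split_ifs with h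
    · exact (L.le_br s h).trans (D.le_branch _ _ (D.br_mem_nextTree i L h))
    · exact D.le_branch _ _ hs

theorem step_br (i : Ordinal.{u}) (L : BranchedCond lam) {s : BinSeq.{u}}
    (hs : s ∈ L.tree.carrier) : (D.step i L).br s = D.branch (D.nextTree i L) (L.br s) := by
  simp only [step, if_pos hs]

theorem le_step (i : Ordinal.{u}) (L : BranchedCond lam) : L ≤ D.step i L :=
  ⟨D.le_nextTree i L, fun s hs => by
    rw [D.step_br i L hs]
    exact D.le_branch _ _ (D.br_mem_nextTree i L hs)⟩

/-- The first condition, with branches. -/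
def init : BranchedCond lam where
  tree := D.start
  br := D.branch D.start
  br_mem := D.branch_mem _
  le_br := D.le_branch _

/-- The chain of conditions. -/
noncomputable def chain (i : Ordinal.{u}) : BranchedCond lam :=
  -- With `D.init` inserted the set is nonempty at stage zero too, so zero, successor and limit
  -- stages are treated alike.
  D.step i (chainSup D.init (insert D.init {σ | ∃ j, ∃ _ : j < i, σ = chain j}))
termination_by i

/-- The conditions before stage `i`. -/
def below (i : Ordinal.{u}) : Set (BranchedCond lam) :=
  insert D.init {σ | ∃ j, ∃ _ : j < i, σ = D.chain j}

/-- The supremum of the conditions before stage `i`. -/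
noncomputable def lim (i : Ordinal.{u}) : BranchedCond lam := chainSup D.init (D.below i)

theorem chain_eq (i : Ordinal.{u}) : D.chain i = D.step i (D.lim i) := by
  rw [chain]; rfl

end ChainData

/-! ### Heights and limits of the chain below a closed cardinal. -/

namespace ChainData

open BranchedCond

variable {lam : Cardinal.{u}} {D : ChainData lam}

variable (D) in
/-- The cardinal `μ` is closed under the construction. -/
structure IsClosedAt (μ : Cardinal.{u}) : Prop where
  regular : μ.IsRegular
  aleph0_lt : Cardinal.aleph0 < μ
  lt : μ < lam
  start_lt : D.start.height < μ.ord
  next_lt : ∀ T : TreeCond lam, T.height < μ.ord → ∀ i < μ.ord, (D.next i T).height < μ.ord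

variable {μ : Cardinal.{u}}

theorem add_omega0_lt_ord (hμ : Cardinal.aleph0 ≤ μ) {o : Ordinal.{u}} (ho : o < μ.ord)
    (hμ' : Cardinal.aleph0 < μ) : o + Ordinal.omega0 < μ.ord :=
  Ordinal.isPrincipal_add_ord hμ ho (by rwa [← Cardinal.ord_aleph0, Cardinal.ord_lt_ord])

theorem iSup_lt_ord_of_lt (hμ : μ.IsRegular) {i : Ordinal.{u}} (hi : i < μ.ord)
    {f : Ordinal.{u} → Ordinal.{u}} (hf : ∀ j < i, f j < μ.ord) :
    ∃ β < μ.ord, ∀ j < i, f j ≤ β := by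
  refine ⟨⨆ j : i.ToType, f (Ordinal.ToType.toOrd j), ?_, fun j hj => ?_⟩
  · refine Ordinal.iSup_lt_of_lt_cof ?_ fun j => hf _ (Ordinal.ToType.toOrd j).2
    rw [hμ.cof_ord, Cardinal.mk_toType]
    exact Cardinal.lt_ord.1 hi
  · have := Ordinal.le_iSup (fun j : i.ToType => f (Ordinal.ToType.toOrd j))
      (Ordinal.ToType.mk ⟨j, hj⟩)
    simpa using this

theorem mem_below {i j : Ordinal.{u}} (h : j < i) : D.chain j ∈ D.below i :=
  Or.inr ⟨j, h, rfl⟩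

theorem init_mem_below {i : Ordinal.{u}} : D.init ∈ D.below i := Or.inl rfl

/-- What is maintained in the construction up to stage `i`. -/
structure Good (D : ChainData lam) (μ : Cardinal.{u}) (i : Ordinal.{u}) : Prop where
  sup : IsChainSup (D.below i) (D.lim i)
  lt : i < μ.ord → (D.chain i).tree.height < μ.ord

theorem lim_le_chain (i : Ordinal.{u}) : D.lim i ≤ D.chain i := by
  rw [D.chain_eq]; exact D.le_step _ _

theorem height_lim_lt (i : Ordinal.{u}) : (D.lim i).tree.height < (D.chain i).tree.height := by
  rw [D.chain_eq]; exact D.height_lt_height_nextTree _ _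

/-- By induction the earlier stages form a chain with heights below `μ.ord`, so their supremum has
height at most `μ.ord < lam.ord` and is a condition. If `i < μ.ord`, regularity of `μ` makes the
inequality strict and closure under `next` preserves it. At `i = μ.ord` only the existence of the
supremum remains. -/
theorem good (hμ : D.IsClosedAt μ) (i : Ordinal.{u}) (hi : i ≤ μ.ord) : D.Good μ i := by
  induction i using WellFoundedLT.induction with
  | ind i ih =>
    have ih' : ∀ j < i, D.Good μ j := fun j hj => ih j hj (hj.le.trans hi)
    have hlt : ∀ j < i, (D.chain j).tree.height < μ.ord := fun j hj =>
      (ih' j hj).lt (hj.trans_le hi)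
    have hmono : ∀ j < i, ∀ σ ∈ D.below j, σ ≤ D.chain j := fun j hj σ hσ =>
      ((ih' j hj).sup.1 σ hσ).trans (D.lim_le_chain j)
    have hchain : IsChain (· ≤ ·) (D.below i) := by
      rintro σ (rfl | ⟨j, hj, rfl⟩) τ (rfl | ⟨k, hk, rfl⟩) hne
      · exact Or.inl le_rfl
      · exact Or.inl (hmono k hk _ init_mem_below)
      · exact Or.inr (hmono j hj _ init_mem_below)
      · rcases lt_trichotomy j k with h | rfl | h
        · exact Or.inl (hmono k hk _ (mem_below h))
        · exact Or.inl le_rfl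
        · exact Or.inr (hmono j hj _ (mem_below h))
    have hub : μ.ord ∈ upperBounds
        ((fun σ : BranchedCond lam => σ.tree.height) '' D.below i) := by
      rintro _ ⟨σ, rfl | ⟨j, hj, rfl⟩, rfl⟩
      · exact hμ.start_lt.le
      · exact (hlt j hj).le
    have hne : (D.below i).Nonempty := ⟨_, init_mem_below⟩
    have hlub := isLUB_csSup (hne.image (fun σ : BranchedCond lam => σ.tree.height)) ⟨_, hub⟩
    have hle := hlub.2 hub
    obtain ⟨L, hL, -⟩ := exists_isChainSup hne hchain hlub
      (hle.trans_lt (Cardinal.ord_lt_ord.2 hμ.lt))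
    have hsup : IsChainSup (D.below i) (D.lim i) := isChainSup_chainSup ⟨L, hL⟩
    refine ⟨hsup, fun hi' => ?_⟩
    have hlim : (D.lim i).tree.height < μ.ord := by
      obtain ⟨β, hβ, hβ'⟩ := iSup_lt_ord_of_lt hμ.regular hi' hlt
      refine lt_of_le_of_lt (hsup.2.2 ?_) (max_lt hβ hμ.start_lt)
      rintro _ ⟨σ, rfl | ⟨j, hj, rfl⟩, rfl⟩
      · exact le_max_right _ _
      · exact (hβ' j hj).trans (le_max_left _ _)
    rw [D.chain_eq]
    exact hμ.next_lt _ (add_omega0_lt_ord hμ.aleph0_lt.le hlim hμ.aleph0_lt) i hi'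

variable (hμ : D.IsClosedAt μ)
include hμ

theorem chain_le_lim {i j : Ordinal.{u}} (hij : i < j) (hj : j ≤ μ.ord) : D.chain i ≤ D.lim j :=
  (good hμ j hj).sup.1 _ (mem_below hij)

theorem init_le_lim {j : Ordinal.{u}} (hj : j ≤ μ.ord) : D.init ≤ D.lim j :=
  (good hμ j hj).sup.1 _ init_mem_below

theorem le_height_lim {i : Ordinal.{u}} (hi : i ≤ μ.ord) : i ≤ (D.lim i).tree.height := by
  induction i using WellFoundedLT.induction with
  | ind i ih =>
    -- If `h`, the height at stage `i`, were less than `i`, then stage `h` would come earlier and,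
    -- by induction, already have height greater than `h`.
    by_contra hlt
    have h := ih _ (not_le.1 hlt) ((not_le.1 hlt).le.trans hi)
    exact (h.trans_lt (D.height_lim_lt _)).not_ge
      (TreeCond.height_mono (chain_le_lim hμ (not_le.1 hlt) hi).1)

theorem height_lim_ord : (D.lim μ.ord).tree.height = μ.ord := by
  refine le_antisymm ((good hμ _ le_rfl).sup.2.2 ?_) (le_height_lim hμ le_rfl)
  rintro _ ⟨σ, rfl | ⟨j, hj, rfl⟩, rfl⟩
  · exact hμ.start_lt.le
  · exact ((good hμ j hj.le).lt hj).le

theorem start_le_lim : D.start ≤ (D.lim μ.ord).tree := (init_le_lim hμ le_rfl).1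

theorem exists_mem_chain {δ : Ordinal.{u}} (hδ : δ ≤ μ.ord) (hδ0 : 0 < δ) {s : BinSeq.{u}}
    (hs : s ∈ (D.lim δ).tree.carrier) : ∃ j < δ, s ∈ (D.chain j).tree.carrier := by
  obtain ⟨σ, rfl | ⟨j, hj, rfl⟩, h⟩ := (good hμ δ hδ).sup.exists_mem hs
  -- Nodes of the initial condition are credited to stage `0`; hence the hypothesis `0 < δ`.
  · exact ⟨0, hδ0, TreeCond.mem_of_le
      ((init_le_lim hμ zero_le).trans (D.lim_le_chain 0)).1 h⟩
  · exact ⟨j, hj, h⟩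

/-- The stages whose height is equal to their index form a closed unbounded set. -/
theorem isClub_height_eq :
    IsClub {δ : Set.Iio μ.ord | (D.lim δ).tree.height = δ} := by
  refine ⟨fun d hd hne _ a ha => ?_, fun γ => ?_⟩
  · refine le_antisymm ((good hμ _ a.2.le).sup.2.2 ?_) (le_height_lim hμ a.2.le)
    rintro _ ⟨σ, rfl | ⟨j, hj, rfl⟩, rfl⟩
    · obtain ⟨δ, hδ⟩ := hne
      have h1 := TreeCond.height_mono (init_le_lim hμ (le_of_lt δ.2)).1
      rw [hd hδ] at h1
      exact h1.trans (ha.1 hδ)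
    · obtain ⟨δ, hδ, hjδ⟩ := (lt_isLUB_iff ha (b := ⟨j, hj.trans a.2⟩)).1 hj
      have h1 := TreeCond.height_mono (chain_le_lim hμ hjδ (le_of_lt δ.2)).1
      rw [hd hδ] at h1
      exact h1.trans (ha.1 hδ)
  -- Iterating `f` from `γ` for `ω` steps stays below the uncountable regular `μ` and closes off
  -- under taking heights of stages.
  · let f : Ordinal.{u} → Ordinal.{u} := fun x => Order.succ (D.chain x).tree.height
    have hlim : Order.IsSuccLimit μ.ord := Cardinal.isSuccLimit_ord hμ.aleph0_lt.le
    have hδ : Ordinal.nfp f γ < μ.ord :=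
      Cardinal.nfp_lt_ord_of_isRegular hμ.regular hμ.aleph0_lt.ne'
        (fun i hi => hlim.succ_lt ((good hμ i hi.le).lt hi)) γ.2
    refine ⟨⟨_, hδ⟩, le_antisymm ((good hμ _ hδ.le).sup.2.2 ?_) (le_height_lim hμ hδ.le),
      Ordinal.le_nfp f γ⟩
    have key : ∀ n, (D.chain (f^[n] γ)).tree.height ≤ Ordinal.nfp f γ := fun n => by
      have h := Ordinal.iterate_le_nfp f γ (n + 1)
      rw [Function.iterate_succ_apply'] at h
      exact (Order.le_succ _).trans h
    rintro _ ⟨σ, rfl | ⟨j, hj, rfl⟩, rfl⟩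
    · exact (TreeCond.height_mono
        ((init_le_lim hμ (le_of_lt γ.2)).trans (D.lim_le_chain _)).1).trans (key 0)
    · obtain ⟨n, hn⟩ := Ordinal.lt_nfp_iff.1 hj
      have hn' : f^[n] γ < μ.ord := (Ordinal.iterate_le_nfp f γ n).trans_lt hδ
      exact (TreeCond.height_mono
        ((chain_le_lim hμ hn hn'.le).trans (D.lim_le_chain _)).1).trans (key n)

end ChainData

/-! ### Cardinalities -/

section Cardinality

open Cardinal

variable {lam : Cardinal.{u}}

/-- A sequence is coded by its length and the set of places where it is `true`, and `lam` is a
strong limit. -/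
theorem mk_binSeq_lt (hlam : lam.IsInaccessible) {α : Ordinal.{u}} (hα : α < lam.ord) :
    have := small_binSeq_lt α
    #(Shrink.{u} {s : BinSeq.{u} // s.len < α}) < lam := by
  have := small_binSeq_lt α
  have hc : α.card < lam := lt_ord.1 hα
  let f : Shrink.{u} {s : BinSeq.{u} // s.len < α} → α.ToType × Set α.ToType := fun s =>
    (Ordinal.ToType.mk ⟨((equivShrink _).symm s).1.len, ((equivShrink _).symm s).2⟩,
      {ξ | ((equivShrink _).symm s).1.val (Ordinal.ToType.toOrd ξ) = true})
  have hf : Function.Injective f := by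
    intro a b h
    obtain ⟨s, rfl⟩ := (equivShrink _).surjective a
    obtain ⟨t, rfl⟩ := (equivShrink _).surjective b
    simp only [f, Prod.mk.injEq, Equiv.symm_apply_apply, EmbeddingLike.apply_eq_iff_eq,
      Subtype.mk.injEq] at h
    congr 1
    refine Subtype.ext (BinSeq.ext h.1 (funext fun ξ => ?_))
    rcases lt_or_ge ξ α with hξ | hξ
    · have := Set.ext_iff.1 h.2 (Ordinal.ToType.mk ⟨ξ, hξ⟩)
      simp only [Set.mem_ofPred_eq, OrderIso.symm_apply_apply] at this
      exact Bool.eq_iff_iff.2 this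
    · rw [s.1.val_of_le ξ (s.2.le.trans hξ), t.1.val_of_le ξ (t.2.le.trans hξ)]
  refine (mk_le_of_injective hf).trans_lt ?_
  rw [mk_prod, lift_id, lift_id, mk_set, mk_toType]
  exact mul_lt_of_lt hlam.aleph0_lt.le hc (hlam.isStrongLimit.isStrongPrelimit hc)

/-- The carrier determines the height, so a condition is coded by a set of sequences of length below
`α`. -/
theorem mk_treeCond_lt (hlam : lam.IsInaccessible) {α : Ordinal.{u}} (hα : α < lam.ord) :
    #(Shrink.{u} {T : TreeCond lam // T.height < α}) < lam := by
  have := small_binSeq_lt α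
  let f : Shrink.{u} {T : TreeCond lam // T.height < α} →
      Set (Shrink.{u} {s : BinSeq.{u} // s.len < α}) := fun T =>
    {s | ((equivShrink _).symm s).1 ∈ ((equivShrink _).symm T).1.carrier}
  have hf : Function.Injective f := by
    intro a b h
    obtain ⟨⟨T₁, h₁⟩, rfl⟩ := (equivShrink _).surjective a
    obtain ⟨⟨T₂, h₂⟩, rfl⟩ := (equivShrink _).surjective b
    have hmem : ∀ s (hs : s.len < α), s ∈ T₁.carrier ↔ s ∈ T₂.carrier := fun s hs => by
      simpa [f] using Set.ext_iff.1 h (equivShrink _ ⟨s, hs⟩)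
    have hc : T₁.carrier = T₂.carrier := by
      ext s
      exact ⟨fun hs => (hmem s ((T₁.isTree.len_lt s hs).trans h₁)).1 hs,
        fun hs => (hmem s ((T₂.isTree.len_lt s hs).trans h₂)).2 hs⟩
    congr 1
    exact Subtype.ext (TreeCond.ext (le_antisymm (TreeCond.height_le_of_subset hc.subset)
      (TreeCond.height_le_of_subset hc.symm.subset)) hc)
  refine (mk_le_of_injective hf).trans_lt ?_
  rw [mk_set]
  exact hlam.isStrongLimit.isStrongPrelimit (mk_binSeq_lt hlam hα)

theorem exists_bound_of_mk_lt (hlam : lam.IsRegular) {ι : Type (u + 1)} [Small.{u} ι]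
    (hι : #(Shrink.{u} ι) < lam) {f : ι → Ordinal.{u}} (hf : ∀ a, f a < lam.ord) :
    ∃ β < lam.ord, ∀ a, f a ≤ β := by
  refine ⟨⨆ a : Shrink.{u} ι, f ((equivShrink ι).symm a), ?_, fun a => ?_⟩
  · exact Ordinal.iSup_lt_of_lt_cof (by rwa [hlam.cof_ord]) fun a => hf _
  · simpa using Ordinal.le_iSup (fun a : Shrink.{u} ι => f ((equivShrink ι).symm a))
      (equivShrink ι a)

/-- Every function which bounds heights has closure points in a stationary set. -/
theorem exists_isClosed {S : Set Cardinal.{u}} (hlam : lam.IsInaccessible)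
    (hS : StationaryIn lam.ord (Cardinal.ord '' S))
    (F : Ordinal.{u} → TreeCond lam → TreeCond lam) {γ : Ordinal.{u}} (hγ : γ < lam.ord) :
    ∃ μ ∈ S, γ < μ.ord ∧
      ∀ T : TreeCond lam, T.height < μ.ord → ∀ i < μ.ord, (F i T).height < μ.ord := by
  -- Fewer than `lam` pairs `(i, T)` matter for a given `x`, so regularity bounds the heights of all
  -- `F i T` by some `g x`. The closure points of `g` above `γ` provide the club.
  have hg : ∀ x, ∃ β, x < lam.ord → β < lam.ord ∧
      ∀ T : TreeCond lam, T.height < x → ∀ i < x, (F i T).height ≤ β := by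
    intro x
    by_cases hx : x < lam.ord
    · have h1 : ∀ i, ∃ β < lam.ord, ∀ T : TreeCond lam, T.height < x → (F i T).height ≤ β := by
        intro i
        obtain ⟨β, hβ, h⟩ := exists_bound_of_mk_lt hlam.isRegular (mk_treeCond_lt hlam hx)
          (f := fun T => (F i T.1).height) fun T => (F i T.1).height_lt
        exact ⟨β, hβ, fun T hT => h ⟨T, hT⟩⟩
      choose b hb hb' using h1
      obtain ⟨β, hβ, h⟩ := ChainData.iSup_lt_ord_of_lt hlam.isRegular hx fun j _ => hb j
      exact ⟨β, fun _ => ⟨hβ, fun T hT i hi => (hb' i T hT).trans (h i hi)⟩⟩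
    · exact ⟨0, fun h => absurd h hx⟩
  choose g hg using hg
  have hlim : Order.IsSuccLimit lam.ord := Cardinal.isSuccLimit_ord hlam.aleph0_lt.le
  have hclub : IsClub {o : Set.Iio lam.ord | γ < o ∧
      ∀ T : TreeCond lam, T.height < o → ∀ i < (o : Ordinal.{u}), (F i T).height < o} := by
    refine ⟨fun d hd hne _ a ha => ⟨?_, fun T hT i hi => ?_⟩, fun δ => ?_⟩
    · obtain ⟨δ, hδ⟩ := hne
      exact (hd hδ).1.trans_le (ha.1 hδ)
    · obtain ⟨o, ho, hlt⟩ := (lt_isLUB_iff ha (b := ⟨max T.height i,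
        (max_lt hT hi).trans a.2⟩)).1 (max_lt hT hi : max T.height i < (a : Ordinal.{u}))
      have hlt' : max T.height i < (o : Ordinal.{u}) := hlt
      exact ((hd ho).2 T ((le_max_left _ _).trans_lt hlt') i
        ((le_max_right _ _).trans_lt hlt')).trans_le (ha.1 ho)
    · let f : Ordinal.{u} → Ordinal.{u} := fun x => Order.succ (max x (g x))
      have hδ0 : max (δ : Ordinal.{u}) (Order.succ γ) < lam.ord := max_lt δ.2 (hlim.succ_lt hγ)
      have hε : Ordinal.nfp f (max δ (Order.succ γ)) < lam.ord :=
        Cardinal.nfp_lt_ord_of_isRegular hlam.isRegular hlam.aleph0_lt.ne'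
          (fun i hi => hlim.succ_lt (max_lt hi (hg i hi).1)) hδ0
      have hle := Ordinal.le_nfp f (max (δ : Ordinal.{u}) (Order.succ γ))
      refine ⟨⟨_, hε⟩, ⟨(Order.lt_succ γ).trans_le ((le_max_right _ _).trans hle),
        fun T hT i hi => ?_⟩,
        (le_max_left (δ : Ordinal.{u}) (Order.succ γ)).trans hle⟩
      obtain ⟨n, hn⟩ := Ordinal.lt_nfp_iff.1 (max_lt hT hi :
        max T.height i < Ordinal.nfp f (max δ (Order.succ γ)))
      have hx := (Ordinal.iterate_le_nfp f (max (δ : Ordinal.{u}) (Order.succ γ)) n).trans_lt hε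
      have h1 := (hg _ hx).2 T ((le_max_left _ _).trans_lt hn) i ((le_max_right _ _).trans_lt hn)
      have h2 := Ordinal.iterate_le_nfp f (max (δ : Ordinal.{u}) (Order.succ γ)) (n + 1)
      rw [Function.iterate_succ_apply'] at h2
      exact (h1.trans (le_max_right _ _)).trans_lt ((Order.lt_succ _).trans_le h2)
  obtain ⟨o, ⟨μ, hμ, hμo⟩, ho⟩ := hS hclub
  have ho' : γ < (o : Ordinal.{u}) ∧
      ∀ T : TreeCond lam, T.height < o → ∀ i < (o : Ordinal.{u}), (F i T).height < o := ho
  rw [← hμo] at ho'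
  exact ⟨μ, hμ, ho'⟩

end Cardinality

/-! ### Distributivity and sealing -/

section Sealing

open Cardinal BranchedCond

variable {lam : Cardinal.{u}} {S : Set Cardinal.{u}}

/-- Move from `s` to a node above it satisfying `B`, if there is one, and then apply true height. -/
theorem exists_branch_fun (B : TreeCond lam → BinSeq.{u} → Prop) :
    ∃ c : TreeCond lam → BinSeq.{u} → BinSeq.{u}, ∀ T : TreeCond lam, ∀ s ∈ T.carrier,
      c T s ∈ treeLim T.carrier T.height ∧ s ≤ c T s ∧
      ((∃ t ∈ T.carrier, s ≤ t ∧ B T t) → ∃ t, t ≤ c T s ∧ B T t) := by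
  have h : ∀ (T : TreeCond lam) (s : BinSeq.{u}), ∃ b : BinSeq.{u}, s ∈ T.carrier →
      b ∈ treeLim T.carrier T.height ∧ s ≤ b ∧
      ((∃ t ∈ T.carrier, s ≤ t ∧ B T t) → ∃ t, t ≤ b ∧ B T t) := by
    intro T s
    by_cases hs : s ∈ T.carrier
    · by_cases ht : ∃ t ∈ T.carrier, s ≤ t ∧ B T t
      · obtain ⟨t, ht, hst, hB⟩ := ht
        obtain ⟨b, hb, htb⟩ := T.trueHeight t ht
        exact ⟨b, fun _ => ⟨hb, hst.trans htb, fun _ => ⟨t, htb, hB⟩⟩⟩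
      · obtain ⟨b, hb, hsb⟩ := T.trueHeight s hs
        exact ⟨b, fun _ => ⟨hb, hsb, fun h => absurd h ht⟩⟩
    · exact ⟨s, fun h => absurd h hs⟩
  choose c hc using h
  exact ⟨c, hc⟩

/-- The data of the construction for given choice functions. -/
def ChainData.ofFun (hlam : lam.IsInaccessible) (p : TreeCond lam)
    (F : Ordinal.{u} → TreeCond lam → TreeCond lam) (hF : ∀ i T, T ≤ F i T)
    (c : TreeCond lam → BinSeq.{u} → BinSeq.{u})
    (hc : ∀ T : TreeCond lam, ∀ s ∈ T.carrier, c T s ∈ treeLim T.carrier T.height ∧ s ≤ c T s)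
    (ν : Ordinal.{u} → BinSeq.{u}) : ChainData lam where
  add_omega0_lt _ ho := ChainData.add_omega0_lt_ord hlam.aleph0_lt.le ho hlam.aleph0_lt
  next := F
  le_next := hF
  branch := c
  branch_mem T s hs := (hc T s hs).1
  le_branch T s hs := (hc T s hs).2
  guess := ν
  start := p

variable (hlam : lam.IsInaccessible) (hS : ∀ μ ∈ S, μ < lam ∧ μ.IsInaccessible)
  (hstat : StationaryIn lam.ord (Cardinal.ord '' S))

include hlam hS hstat

/-- Fewer than `lam` dense open sets of conditions are met by a single condition. -/
theorem exists_forall_of_dense (p : TreeCond lam) {γ : Ordinal.{u}} (hγ : γ < lam.ord)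
    {ι : Type u} (hι : #ι < lam) (D : ι → TreeCond lam → Prop)
    (hmono : ∀ a T T', T ≤ T' → D a T → D a T')
    (hdense : ∀ a T, p ≤ T → ∃ T', T ≤ T' ∧ D a T') :
    ∃ q, p ≤ q ∧ γ < q.height ∧ ∀ a, D a q := by
  obtain ⟨e⟩ : Nonempty (ι ≃ (#ι).ord.ToType) := by
    rw [← Cardinal.eq, Cardinal.mk_toType, Cardinal.card_ord]
  -- Stage `i` enters the dense set with index `i` under `e`; stages without a dense set do nothing.
  have hF : ∀ (i : Ordinal.{u}) (T : TreeCond lam), ∃ T', T ≤ T' ∧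
      (p ≤ T → ∀ a, (Ordinal.ToType.toOrd (e a) : Ordinal.{u}) = i → D a T') := by
    intro i T
    by_cases h : p ≤ T ∧ ∃ a, (Ordinal.ToType.toOrd (e a) : Ordinal.{u}) = i
    · obtain ⟨hp, a, ha⟩ := h
      obtain ⟨T', hT, hD⟩ := hdense a T hp
      refine ⟨T', hT, fun _ b hb => ?_⟩
      have hab : a = b := e.injective (Ordinal.ToType.mk.symm.injective
        (Subtype.ext (ha.trans hb.symm)))
      exact hab ▸ hD
    · exact ⟨T, le_rfl, fun hp a ha => absurd ⟨hp, a, ha⟩ h⟩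
  choose F hF hF' using hF
  obtain ⟨c, hc⟩ := exists_branch_fun (lam := lam) fun _ _ => True
  have hι' : (#ι).ord < lam.ord := Cardinal.ord_lt_ord.2 hι
  obtain ⟨μ, hμ, hγμ, hcl⟩ := exists_isClosed hlam hstat F
    (max_lt (max_lt hγ hι') p.height_lt)
  -- The guess `nil` has length `0` and is never a branch of a condition, so nothing is omitted.
  let E := ChainData.ofFun hlam p F hF c (fun T s hs => ⟨(hc T s hs).1, (hc T s hs).2.1⟩)
    fun _ => nil
  have hE : E.IsClosedAt μ := ⟨(hS μ hμ).2.isRegular, (hS μ hμ).2.aleph0_lt, (hS μ hμ).1,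
    (le_max_right _ _).trans_lt hγμ, hcl⟩
  refine ⟨(E.lim μ.ord).tree, ChainData.start_le_lim hE, ?_, fun a => ?_⟩
  · rw [ChainData.height_lim_ord hE]
    exact ((le_max_left _ _).trans (le_max_left _ _)).trans_lt hγμ
  · have hi : (Ordinal.ToType.toOrd (e a) : Ordinal.{u}) < μ.ord :=
      (Set.mem_Iio.1 (Ordinal.ToType.toOrd (e a)).2).trans
        (((le_max_right _ _).trans (le_max_left _ _)).trans_lt hγμ)
    refine hmono a _ _ (ChainData.chain_le_lim hE hi le_rfl).1 ?_
    rw [ChainData.chain_eq]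
    refine hF' _ _ ?_ a rfl
    exact (ChainData.init_le_lim hE hi.le).1.trans TreeCond.le_extend

theorem exists_lt_height (p : TreeCond lam) {γ : Ordinal.{u}} (hγ : γ < lam.ord) :
    ∃ q, p ≤ q ∧ γ < q.height := by
  obtain ⟨q, h, h', -⟩ := exists_forall_of_dense hlam hS hstat p hγ (ι := PEmpty)
    (by rw [Cardinal.mk_pempty]; exact hlam.pos) (fun a => a.elim) (fun a => a.elim)
    (fun a => a.elim)
  exact ⟨q, h, h'⟩

/-- A dense set of nodes can be sealed: some condition forces every node of a certain level to be
above an element of it. -/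
theorem exists_sealed {S₀ : Set Ordinal.{u}} (hS₀ : ∀ δ ∈ S₀, δ < lam.ord ∧ Order.IsSuccLimit δ)
    (hdiamond : ∀ μ ∈ S, Diamond S₀ μ.ord) (B : TreeCond lam → BinSeq.{u} → Prop)
    (hmono : ∀ T T' s, T ≤ T' → B T s → B T' s)
    (p : TreeCond lam)
    (hdense : ∀ T, p ≤ T → ∀ s ∈ T.carrier, ∃ T', T ≤ T' ∧ ∃ t ∈ T'.carrier, s ≤ t ∧ B T' t) :
    ∃ q, p ≤ q ∧ ∃ μ < q.height, ∀ s ∈ q.carrier, s.len = μ →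
      ∃ t, t ≤ s ∧ t.len < μ ∧ B q t := by
  -- Distributivity, indexed by all sequences shorter than `T.height`, treats all nodes of `T` in
  -- one extension.
  have hF : ∀ T : TreeCond lam, ∃ T', T ≤ T' ∧
      (p ≤ T → ∀ s ∈ T.carrier, ∃ t ∈ T'.carrier, s ≤ t ∧ B T' t) := by
    intro T
    by_cases hp : p ≤ T
    · have := small_binSeq_lt T.height
      obtain ⟨T', hT, -, hT'⟩ := exists_forall_of_dense hlam hS hstat T T.height_lt
        (mk_binSeq_lt hlam T.height_lt)
        (fun a T' => ((equivShrink _).symm a).1 ∈ T.carrier →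
          ∃ t ∈ T'.carrier, ((equivShrink _).symm a).1 ≤ t ∧ B T' t)
        (fun a T₁ T₂ h h₁ h₂ => by
          obtain ⟨t, ht, hst, hB⟩ := h₁ h₂
          exact ⟨t, TreeCond.mem_of_le h ht, hst, hmono _ _ _ h hB⟩)
        (fun a T₁ h₁ => by
          by_cases ha : ((equivShrink _).symm a).1 ∈ T.carrier
          · obtain ⟨T', h, h'⟩ := hdense T₁ (hp.trans h₁) _ (TreeCond.mem_of_le h₁ ha)
            exact ⟨T', h, fun _ => h'⟩
          · exact ⟨T₁, le_rfl, fun h => absurd h ha⟩)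
      refine ⟨T', hT, fun _ s hs => ?_⟩
      simpa using hT' (equivShrink _ ⟨s, T.isTree.len_lt s hs⟩) (by simpa using hs)
    · exact ⟨T, le_rfl, fun h => absurd h hp⟩
  choose F hF hF' using hF
  obtain ⟨c, hc⟩ := exists_branch_fun B
  obtain ⟨μ, hμ, hpμ, hcl⟩ := exists_isClosed hlam hstat (fun _ => F) p.height_lt
  obtain ⟨ν, -, hν⟩ := hdiamond μ hμ
  let E := ChainData.ofFun hlam p (fun _ => F) (fun _ => hF) c
    (fun T s hs => ⟨(hc T s hs).1, (hc T s hs).2.1⟩) ν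
  have hE : E.IsClosedAt μ := ⟨(hS μ hμ).2.isRegular, (hS μ hμ).2.aleph0_lt, (hS μ hμ).1,
    hpμ, hcl⟩
  have hpL : p ≤ (E.lim μ.ord).tree := ChainData.start_le_lim hE
  -- The limit has height exactly `μ.ord`, so level `μ.ord` appears only in a taller condition. Any
  -- such `q` will do, since only the part below `μ.ord` matters.
  obtain ⟨q, hq, hμq⟩ := exists_lt_height hlam hS hstat (E.lim μ.ord).tree
    (Cardinal.ord_lt_ord.2 (hS μ hμ).1)
  refine ⟨q, hpL.trans hq, μ.ord, hμq, fun x hx hxl => ?_⟩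
  have hxL : ∀ β < μ.ord, x.restrict β ∈ (E.lim μ.ord).tree.carrier := fun β hβ =>
    TreeCond.mem_of_le_of_len_lt hq (TreeCond.down_mem hx (x.restrict_le β))
      (by rw [ChainData.height_lim_ord hE]; exact (min_le_right _ _).trans_lt hβ)
  obtain ⟨δ, ⟨hδS, hδν⟩, hδ⟩ := hν x hxl (ChainData.isClub_height_eq hE)
  replace hδ : (E.lim δ).tree.height = δ := hδ
  have hδμ : (δ : Ordinal.{u}) < μ.ord := δ.2
  have hδlim := (hS₀ _ hδS).2
  have hxδ : (x.restrict δ).len = δ := restrict_len_of_le (by rw [hxl]; exact hδμ.le)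
  -- the branch `x.restrict δ` was kept, and hence is one of the chosen branches
  have hkept : x.restrict δ ∈ (E.lim δ).kept (ν (E.lim δ).tree.height) := by
    have hch : x.restrict δ ∈ (E.chain δ).tree.carrier :=
      TreeCond.mem_of_le_of_len_lt (ChainData.chain_le_lim hE hδμ le_rfl).1 (hxL δ hδμ)
        (by rw [hxδ]; exact hδ.symm.trans_lt (ChainData.height_lim_lt (D := E) δ))
    rw [ChainData.chain_eq] at hch
    refine TreeCond.mem_of_mem_extend (TreeCond.mem_of_le_of_len_lt
      (E.omitBranch_le_nextTree δ (E.lim δ)) hch ?_) (hxδ.trans hδ.symm)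
    exact (hxδ.trans hδ.symm).trans_lt TreeCond.height_lt_height_extend
  obtain ⟨s, hs, hxs⟩ := hkept.2 (by rw [hδ]; exact hδν)
  obtain ⟨j, hj, hsj⟩ := ChainData.exists_mem_chain hE hδμ.le hδlim.bot_lt hs
  -- The node `s` may first appear in the step at stage `j`, where its branch is fresh. At stage
  -- `succ j` it is an old node, and its branch is rerouted through a node satisfying `B`, still
  -- before `δ`.
  have hj1 : Order.succ j < (δ : Ordinal.{u}) := hδlim.succ_lt hj
  have hj1μ := hj1.trans hδμ
  have hsL : s ∈ (E.lim (Order.succ j)).tree.carrier := TreeCond.mem_of_le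
    (ChainData.chain_le_lim hE (Order.lt_succ j) hj1μ.le).1 hsj
  obtain ⟨t, ht, hBt⟩ := (hc _ _ (E.br_mem_nextTree (Order.succ j) _ hsL)).2.2
    (hF' _ ((ChainData.init_le_lim hE hj1μ.le).1.trans TreeCond.le_extend) _ (E.br_mem_omitBranch _ hsL))
  have hbr : (E.chain (Order.succ j)).br s ≤ x.restrict δ := by
    rw [hxs]
    refine (ChainData.chain_le_lim hE hj1 hδμ.le).2 s ?_
    exact TreeCond.mem_of_le (ChainData.lim_le_chain _).1 hsL
  have htx : t ≤ x.restrict δ := by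
    refine le_trans ?_ hbr
    rw [ChainData.chain_eq, E.step_br _ _ hsL]
    exact ht
  refine ⟨t, htx.trans (x.restrict_le δ), ((len_mono htx).trans_eq hxδ).trans_lt hδμ, ?_⟩
  refine hmono _ _ _ ((ChainData.chain_le_lim hE hj1μ le_rfl).1.trans hq) ?_
  rw [ChainData.chain_eq]
  exact hBt

end Sealing

/-! ### The forcing relation -/

namespace FStmt

variable {P : Type v} [Preorder P] {p q : P} {x y z w x' y' z' a b f : PName.{u, v} P}

/-- The condition that `φ` is regular: it is preserved by stronger conditions and holds where it
holds densely. -/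
class Reg (φ : FStmt P) : Prop where
  mono : ∀ {p q}, p ≤ q → φ p → φ q
  dense : ∀ {p}, (∀ q, p ≤ q → ∃ r, q ≤ r ∧ φ r) → φ p

theorem eq_mk {ι κ : Type u} {A : ι → PName P} {a : ι → P} {B : κ → PName P} {b : κ → P} :
    eq (.mk ι A a) (.mk κ B b) p ↔
    (∀ i : ι, ∀ q, p ≤ q → a i ≤ q →
      ∀ q', q ≤ q' → ∃ r, q' ≤ r ∧ ∃ j : κ, b j ≤ r ∧ eq (A i) (B j) r) ∧
    (∀ j : κ, ∀ q, p ≤ q → b j ≤ q →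
      ∀ q', q ≤ q' → ∃ r, q' ≤ r ∧ ∃ i : ι, a i ≤ r ∧ eq (A i) (B j) r) := by
  rw [FStmt.eq]

theorem mem_mk {κ : Type u} {B : κ → PName P} {b : κ → P} :
    mem x (.mk κ B b) p ↔ ∀ q, p ≤ q → ∃ r, q ≤ r ∧ ∃ j : κ, b j ≤ r ∧ eq x (B j) r := Iff.rfl

instance : Reg (eq x y) where
  mono {p q} h := by
    cases x; cases y
    rw [eq_mk, eq_mk]
    exact fun H => ⟨fun i q' h' => H.1 i q' (h.trans h'), fun j q' h' => H.2 j q' (h.trans h')⟩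
  dense {p} H := by
    cases x; cases y
    rw [eq_mk]
    constructor
    · intro i q hq hi q' hq'
      obtain ⟨r, hr, h⟩ := H q' (hq.trans hq')
      rw [eq_mk] at h
      obtain ⟨r', hr', h'⟩ := h.1 i r le_rfl (hi.trans (hq'.trans hr)) r le_rfl
      exact ⟨r', hr.trans hr', h'⟩
    · intro i q hq hi q' hq'
      obtain ⟨r, hr, h⟩ := H q' (hq.trans hq')
      rw [eq_mk] at h
      obtain ⟨r', hr', h'⟩ := h.2 i r le_rfl (hi.trans (hq'.trans hr)) r le_rfl
      exact ⟨r', hr.trans hr', h'⟩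

instance : Reg (mem x y) where
  mono {p q} h := by
    cases y
    exact fun H q' h' => H q' (h.trans h')
  dense {p} H := by
    cases y
    intro q hq
    obtain ⟨r, hr, h⟩ := H q hq
    obtain ⟨r', hr', h'⟩ := h r le_rfl
    exact ⟨r', hr.trans hr', h'⟩

variable {φ ψ : FStmt P} {Φ Ψ : PName.{u, v} P → FStmt P}

instance [Reg φ] : Reg (not φ) where
  mono h H _ hq := H _ (h.trans hq)
  dense H q hq hφ := by
    obtain ⟨r, hr, h⟩ := H q hq
    exact h r le_rfl (Reg.mono hr hφ)

instance [Reg φ] [Reg ψ] : Reg (φ ∧ᶠ ψ) where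
  mono h H := ⟨Reg.mono h H.1, Reg.mono h H.2⟩
  dense H := ⟨Reg.dense fun q hq => (H q hq).imp fun _ h => ⟨h.1, h.2.1⟩,
    Reg.dense fun q hq => (H q hq).imp fun _ h => ⟨h.1, h.2.2⟩⟩

instance : Reg (φ ∨ᶠ ψ) where
  mono h H q hq := H q (h.trans hq)
  dense H q hq := by
    obtain ⟨r, hr, h⟩ := H q hq
    obtain ⟨r', hr', h'⟩ := h r le_rfl
    exact ⟨r', hr.trans hr', h'⟩

instance [Reg φ] : Reg (φ →ᶠ ψ) where
  mono h H q hq := H q (h.trans hq)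
  dense H q hq hφ := by
    obtain ⟨r, hr, h⟩ := H q hq
    obtain ⟨r', hr', h'⟩ := h r le_rfl (Reg.mono hr hφ)
    exact ⟨r', hr.trans hr', h'⟩

instance [∀ x, Reg (Φ x)] : Reg (all Φ) where
  mono h H x := Reg.mono h (H x)
  dense H x := Reg.dense fun q hq => (H q hq).imp fun _ h => ⟨h.1, h.2 x⟩

instance : Reg (ex Φ) where
  mono h H q hq := H q (h.trans hq)
  dense H q hq := by
    obtain ⟨r, hr, h⟩ := H q hq
    obtain ⟨r', hr', h'⟩ := h r le_rfl
    exact ⟨r', hr.trans hr', h'⟩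

instance [Reg φ] [Reg ψ] : Reg (iff φ ψ) := by unfold iff; infer_instance

instance [∀ x, Reg (Φ x)] : Reg (allIn a Φ) := by unfold allIn; infer_instance

instance : Reg (exIn a Φ) := by unfold exIn; infer_instance

instance : Reg (sub x y) := by unfold sub; infer_instance

/-- Regularity of `ψ` absorbs the density in the definition, so forced implications and bounded
quantifiers can be handled as ordinary ones above `p`. -/
theorem imp_iff [Reg φ] [Reg ψ] : (φ →ᶠ ψ) p ↔ ∀ q, p ≤ q → φ q → ψ q :=
  ⟨fun H _ hq hφ => Reg.dense fun q' hq' => H q' (hq.trans hq') (Reg.mono hq' hφ),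
    fun H q hq hφ => ⟨q, le_rfl, H q hq hφ⟩⟩

theorem iff_iff [Reg φ] [Reg ψ] : iff φ ψ p ↔ ∀ q, p ≤ q → (φ q ↔ ψ q) :=
  ⟨fun H q hq => ⟨imp_iff.1 H.1 q hq, imp_iff.1 H.2 q hq⟩,
    fun H => ⟨imp_iff.2 fun q hq => (H q hq).1, imp_iff.2 fun q hq => (H q hq).2⟩⟩

theorem allIn_iff [∀ x, Reg (Φ x)] :
    allIn a Φ p ↔ ∀ x q, p ≤ q → mem x a q → Φ x q :=
  forall_congr' fun _ => imp_iff

theorem sub_iff : sub x y p ↔ ∀ z q, p ≤ q → mem z x q → mem z y q := allIn_iff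

theorem exIn_intro (x : PName.{u, v} P) [Reg (Φ x)] (h : mem x a p) (h' : Φ x p) :
    exIn a Φ p := fun q hq => ⟨q, le_rfl, x, Reg.mono hq h, Reg.mono hq h'⟩

theorem ex_intro (x : PName.{u, v} P) [Reg (Φ x)] (h' : Φ x p) :
    ex Φ p := fun q hq => ⟨q, le_rfl, x, Reg.mono hq h'⟩

/-- Witnesses exist only densely, but for a regular goal that is enough; the other elimination
lemmas use the same principle. -/
theorem exIn_elim [Reg ψ] (h : exIn a Φ p)
    (H : ∀ r, p ≤ r → ∀ x, mem x a r → Φ x r → ψ r) : ψ p :=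
  Reg.dense fun q hq => by
    obtain ⟨r, hr, x, hx, hΦ⟩ := h q hq
    exact ⟨r, hr, H r (hq.trans hr) x hx hΦ⟩

theorem or_elim [Reg ψ] {φ₁ φ₂ : FStmt P} (h : (φ₁ ∨ᶠ φ₂) p) (H₁ : ∀ r, p ≤ r → φ₁ r → ψ r)
    (H₂ : ∀ r, p ≤ r → φ₂ r → ψ r) : ψ p :=
  Reg.dense fun q hq => by
    obtain ⟨r, hr, h | h⟩ := h q hq
    · exact ⟨r, hr, H₁ r (hq.trans hr) h⟩
    · exact ⟨r, hr, H₂ r (hq.trans hr) h⟩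

theorem or_inl [Reg φ] (h : φ p) : (φ ∨ᶠ ψ) p := fun q hq => ⟨q, le_rfl, Or.inl (Reg.mono hq h)⟩

theorem or_inr [Reg ψ] (h : ψ p) : (φ ∨ᶠ ψ) p := fun q hq => ⟨q, le_rfl, Or.inr (Reg.mono hq h)⟩

/-! Equality and membership. -/

theorem eq_refl (x : PName.{u, v} P) (p : P) : eq x x p := by
  induction x generalizing p with
  | mk ι A a ih =>
    rw [eq_mk]
    exact ⟨fun i q _ hi q' hq' => ⟨q', le_rfl, i, hi.trans hq', ih i q'⟩,
      fun i q _ hi q' hq' => ⟨q', le_rfl, i, hi.trans hq', ih i q'⟩⟩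

theorem eq_symm (h : eq x y p) : eq y x p := by
  induction x generalizing y p with
  | mk ι A a ih =>
    cases y
    rw [eq_mk] at h ⊢
    refine ⟨fun j q hq hj q' hq' => ?_, fun i q hq hi q' hq' => ?_⟩
    · obtain ⟨r, hr, i, hi, h'⟩ := h.2 j q hq hj q' hq'
      exact ⟨r, hr, i, hi, ih i h'⟩
    · obtain ⟨r, hr, i', hi, h'⟩ := h.1 i q hq hi q' hq'
      exact ⟨r, hr, i', hi, ih i h'⟩

theorem eq_trans (h₁ : eq x y p) (h₂ : eq y z p) : eq x z p := by
  induction x generalizing y z p with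
  | mk ι A a ih =>
    cases y
    cases z
    rw [eq_mk] at h₁ h₂ ⊢
    refine ⟨fun i q hq hi q' hq' => ?_, fun k q hq hk q' hq' => ?_⟩
    · obtain ⟨r, hr, j, hj, h⟩ := h₁.1 i q hq hi q' hq'
      obtain ⟨r', hr', k, hk, h'⟩ := h₂.1 j r (hq.trans (hq'.trans hr)) hj r le_rfl
      exact ⟨r', hr.trans hr', k, hk, ih i (Reg.mono hr' h) h'⟩
    · obtain ⟨r, hr, j, hj, h⟩ := h₂.2 k q hq hk q' hq'
      obtain ⟨r', hr', i, hi, h'⟩ := h₁.2 j r (hq.trans (hq'.trans hr)) hj r le_rfl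
      exact ⟨r', hr.trans hr', i, hi, ih i h' (Reg.mono hr' h)⟩

theorem mem_congr_left (h : eq x x' p) (hx : mem x y p) : mem x' y p := by
  cases y
  intro q hq
  obtain ⟨r, hr, j, hj, h'⟩ := hx q hq
  exact ⟨r, hr, j, hj, eq_trans (eq_symm (Reg.mono (hq.trans hr) h)) h'⟩

theorem mem_congr_right (h : eq y y' p) (hx : mem x y p) : mem x y' p := by
  cases y
  cases y'
  rw [eq_mk] at h
  intro q hq
  obtain ⟨r, hr, j, hj, h₁⟩ := hx q hq
  obtain ⟨r', hr', k, hk, h₂⟩ := h.1 j r (hq.trans hr) hj r le_rfl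
  exact ⟨r', hr.trans hr', k, hk, eq_trans (Reg.mono hr' h₁) h₂⟩

theorem mem_of_index {κ : Type u} {B : κ → PName P} {b : κ → P} {j : κ} (h : b j ≤ p) :
    mem (B j) (.mk κ B b) p :=
  fun q hq => ⟨q, le_rfl, j, h.trans hq, eq_refl _ _⟩

theorem eq_of_forall (h : ∀ z q, p ≤ q → (mem z x q ↔ mem z y q)) : eq x y p := by
  cases x
  cases y
  rw [eq_mk]
  refine ⟨fun i q hq hi q' hq' => ?_, fun j q hq hj q' hq' => ?_⟩
  · exact (h _ q' (hq.trans hq')).1 (mem_of_index (hi.trans hq')) q' le_rfl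
  · obtain ⟨r, hr, i, hi, h'⟩ :=
      (h _ q' (hq.trans hq')).2 (mem_of_index (hj.trans hq')) q' le_rfl
    exact ⟨r, hr, i, hi, eq_symm h'⟩

theorem sub_congr (hx : eq x x' p) (hy : eq y y' p) (h : sub x y p) : sub x' y' p :=
  sub_iff.2 fun z q hq hz => mem_congr_right (Reg.mono hq hy)
    (sub_iff.1 h z q hq (mem_congr_right (eq_symm (Reg.mono hq hx)) hz))

/-! Names of pairs and of sets of the ground model. -/

theorem mem_ofSmall {ι : Type*} [Small.{u} ι] {elt : ι → PName.{u, v} P} {cond : ι → P} :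
    mem x (.ofSmall elt cond) p ↔ ∀ q, p ≤ q → ∃ r, q ≤ r ∧ ∃ i, cond i ≤ r ∧ eq x (elt i) r := by
  unfold PName.ofSmall
  rw [mem_mk]
  refine forall₂_congr fun q _ => exists_congr fun r => and_congr_right fun _ => ?_
  exact ⟨fun ⟨j, h⟩ => ⟨_, h⟩, fun ⟨i, h⟩ => ⟨equivShrink _ i, by simpa using h⟩⟩

theorem mem_ofSmall_self {ι : Type*} [Small.{u} ι] {elt : ι → PName.{u, v} P} {cond : ι → P}
    (i : ι) (h : cond i ≤ p) : mem (elt i) (.ofSmall elt cond) p :=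
  mem_ofSmall.2 fun q hq => ⟨q, le_rfl, i, h.trans hq, eq_refl _ _⟩

variable [Small.{u} P]

theorem mem_upair : mem z (.upair x y) p ↔ (eq z x ∨ᶠ eq z y) p := by
  unfold PName.upair
  rw [mem_ofSmall]
  refine forall₂_congr fun q _ => exists_congr fun r => and_congr_right fun _ => ?_
  constructor
  · rintro ⟨⟨b, s⟩, -, h⟩
    cases b
    · exact Or.inr h
    · exact Or.inl h
  · rintro (h | h)
    · exact ⟨(true, r), le_rfl, h⟩
    · exact ⟨(false, r), le_rfl, h⟩

theorem left_mem_upair : mem x (.upair x y) p := mem_upair.2 (or_inl (eq_refl _ _))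

theorem right_mem_upair : mem y (.upair x y) p := mem_upair.2 (or_inr (eq_refl _ _))

theorem upair_congr (hx : eq x x' p) (hy : eq y y' p) : eq (.upair x y) (.upair x' y') p := by
  refine eq_of_forall fun z q hq => ?_
  rw [mem_upair, mem_upair]
  exact ⟨fun h => or_elim h (fun r hr h => or_inl (eq_trans h (Reg.mono (hq.trans hr) hx)))
      fun r hr h => or_inr (eq_trans h (Reg.mono (hq.trans hr) hy)),
    fun h => or_elim h (fun r hr h => or_inl (eq_trans h (eq_symm (Reg.mono (hq.trans hr) hx))))
      fun r hr h => or_inr (eq_trans h (eq_symm (Reg.mono (hq.trans hr) hy)))⟩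

theorem opair_congr (hx : eq x x' p) (hy : eq y y' p) : eq (.opair x y) (.opair x' y') p :=
  upair_congr (upair_congr hx hx) (upair_congr hx hy)

theorem eq_of_singleton_eq_upair (h : eq (.upair x x) (.upair y z) p) : eq x y p ∧ eq x z p := by
  have key : ∀ w, mem w (.upair y z) p → eq x w p := fun w hw =>
    or_elim (mem_upair.1 (mem_congr_right (eq_symm h) hw)) (fun _ _ h => eq_symm h)
      fun _ _ h => eq_symm h
  exact ⟨key y left_mem_upair, key z right_mem_upair⟩

theorem left_eq_of_opair_eq (h : eq (.opair x y) (.opair x' y') p) : eq x x' p :=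
  or_elim (mem_upair.1 (mem_congr_right h left_mem_upair))
    (fun _ _ h => (eq_of_singleton_eq_upair h).1) fun _ _ h => (eq_of_singleton_eq_upair h).1

theorem right_eq_of_opair_eq (h : eq (.opair x y) (.opair x' y') p) : eq y y' p := by
  have hx := left_eq_of_opair_eq h
  -- if `y = x`, then `y'`, which is one of the elements of `{x, y}`, is `y`
  have key : ∀ r, p ≤ r → eq y x r → eq y y' r := fun r hr hy => by
    have h' := Reg.mono hr h
    refine or_elim (mem_upair.1 (mem_congr_right (eq_symm h') right_mem_upair))
      (fun r' hr' h => ?_) fun r' hr' h => ?_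
    · exact eq_trans (Reg.mono hr' hy) (eq_of_singleton_eq_upair (eq_symm h)).2
    · refine or_elim (mem_upair.1 (mem_congr_right h right_mem_upair)) (fun s hs h => ?_)
        fun s hs h => eq_symm h
      exact eq_trans (Reg.mono (hr'.trans hs) hy) (eq_symm h)
  refine or_elim (mem_upair.1 (mem_congr_right h right_mem_upair))
    (fun r hr h => key r hr ?_) fun r hr h => ?_
  · exact eq_trans (eq_symm (eq_of_singleton_eq_upair (eq_symm h)).2)
      (eq_symm (Reg.mono hr hx))
  · refine or_elim (mem_upair.1 (mem_congr_right h right_mem_upair)) (fun s hs h => ?_)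
      fun s hs h => h
    exact key s (hr.trans hs) (eq_trans h (eq_symm (Reg.mono (hr.trans hs) hx)))

end FStmt

/-! ### Names of ground model sets -/

namespace FStmt

variable {P : Type v} [Preorder P] {p q : P} {x y z w x' y' z' a b f : PName.{u, v} P}
  {φ ψ : FStmt P} {Φ Ψ : PName.{u, v} P → FStmt P} [Small.{u} P] {X Y Z : PSet.{u}}

theorem mem_check_iff_index {α : Type u} {A : α → PSet.{u}} :
    mem x (.check ⟨α, A⟩) p ↔ ∀ q, p ≤ q → ∃ r, q ≤ r ∧ ∃ i, eq x (.check (A i)) r := by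
  rw [PName.check, mem_mk]
  refine forall₂_congr fun q _ => exists_congr fun r => and_congr_right fun _ => ?_
  exact ⟨fun ⟨i, _, h⟩ => ⟨i.1, h⟩, fun ⟨i, h⟩ => ⟨(i, equivShrink P r), by simp, h⟩⟩

theorem check_eq_of_equiv (h : X.Equiv Y) (p : P) : eq (.check X) (.check Y) p := by
  induction X generalizing Y p with
  | mk α A ih =>
    obtain ⟨β, B⟩ := Y
    refine eq_of_forall fun z q _ => ?_
    rw [mem_check_iff_index, mem_check_iff_index]
    refine forall₂_congr fun q _ => exists_congr fun r => and_congr_right fun _ => ?_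
    constructor
    · rintro ⟨i, hi⟩
      obtain ⟨j, hj⟩ := h.exists_left i
      exact ⟨j, eq_trans hi (ih i hj r)⟩
    · rintro ⟨j, hj⟩
      obtain ⟨i, hi⟩ := h.exists_right j
      exact ⟨i, eq_trans hj (eq_symm (ih i hi r))⟩

theorem mem_check_iff :
    mem x (.check X) p ↔ ∀ q, p ≤ q → ∃ r, q ≤ r ∧ ∃ Y ∈ X, eq x (.check Y) r := by
  obtain ⟨α, A⟩ := X
  rw [mem_check_iff_index]
  refine forall₂_congr fun q _ => exists_congr fun r => and_congr_right fun _ => ?_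
  constructor
  · rintro ⟨i, h⟩
    exact ⟨A i, PSet.Mem.mk A i, h⟩
  · rintro ⟨Y, ⟨i, hi⟩, h⟩
    exact ⟨i, eq_trans h (check_eq_of_equiv hi r)⟩

theorem check_mem_check (h : Y ∈ X) (p : P) : mem (.check Y) (.check X) p :=
  mem_check_iff.2 fun q _ => ⟨q, le_rfl, Y, h, eq_refl _ _⟩

theorem mem_check_elim [Reg ψ] (h : mem x (.check X) p)
    (H : ∀ r, p ≤ r → ∀ Y ∈ X, eq x (.check Y) r → ψ r) : ψ p :=
  Reg.dense fun q hq => by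
    obtain ⟨r, hr, Y, hY, h⟩ := mem_check_iff.1 h q hq
    exact ⟨r, hr, H r (hq.trans hr) Y hY h⟩

/-- Whether two ground model sets are equal does not depend on the condition, so the matching
elements can be read off at any single stronger condition. -/
theorem equiv_of_check_eq (h : eq (.check X) (.check Y) p) : X.Equiv Y := by
  induction X generalizing Y p with
  | mk α A ih =>
    obtain ⟨β, B⟩ := Y
    refine ⟨fun i => ?_, fun j => ?_⟩
    · obtain ⟨r, -, j, hj⟩ := mem_check_iff_index.1
        (mem_congr_right h (check_mem_check (PSet.Mem.mk A i) p)) p le_rfl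
      exact ⟨j, ih i hj⟩
    · obtain ⟨r, -, i, hi⟩ := mem_check_iff_index.1
        (mem_congr_right (eq_symm h) (check_mem_check (PSet.Mem.mk B j) p)) p le_rfl
      exact ⟨i, ih i (eq_symm hi)⟩

theorem mem_of_check_mem (h : mem (.check X) (.check Y) p) : X ∈ Y := by
  obtain ⟨r, -, Z, hZ, h'⟩ := mem_check_iff.1 h p le_rfl
  exact (PSet.Mem.congr_left (equiv_of_check_eq h')).2 hZ

theorem check_pair_eq (X Y : PSet.{u}) (p : P) :
    eq (.check {X, Y}) (.upair (.check X) (.check Y)) p := by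
  refine eq_of_forall fun z q _ => ?_
  rw [mem_upair]
  constructor
  · refine fun h => mem_check_elim h fun r _ Z hZ h => ?_
    rcases PSet.mem_pair.1 hZ with h' | h'
    · exact or_inl (eq_trans h (check_eq_of_equiv h' r))
    · exact or_inr (eq_trans h (check_eq_of_equiv h' r))
  · refine fun h => or_elim h (fun r _ h => ?_) fun r _ h => ?_
    · exact mem_congr_left (eq_symm h) (check_mem_check (PSet.mem_pair.2 (Or.inl .rfl)) r)
    · exact mem_congr_left (eq_symm h) (check_mem_check (PSet.mem_pair.2 (Or.inr .rfl)) r)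

theorem check_opair_eq (X Y : PSet.{u}) (p : P) :
    eq (.check {{X}, {X, Y}}) (.opair (.check X) (.check Y)) p := by
  refine eq_trans (check_pair_eq _ _ p) (upair_congr ?_ (check_pair_eq _ _ p))
  refine eq_trans (check_eq_of_equiv ?_ p) (check_pair_eq X X p)
  exact PSet.Mem.ext fun w => by simp [PSet.mem_singleton]

/-! Ordinals. -/

section Ordinals

variable {α β : Ordinal.{u}}

/-- The canonical name of an ordinal. -/
noncomputable abbrev ord (α : Ordinal.{u}) : PName.{u, v} P := .check α.toPSet

theorem toPSet_equiv_iff : α.toPSet.Equiv β.toPSet ↔ α = β :=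
  ⟨fun h => by
    rw [← Ordinal.rank_toPSet α, ← Ordinal.rank_toPSet β]
    exact PSet.rank_congr h, fun h => h ▸ .rfl⟩

theorem toPSet_mem_iff : α.toPSet ∈ β.toPSet ↔ α < β := by
  rw [Ordinal.mem_toPSet_iff]
  exact ⟨fun ⟨γ, hγ, h⟩ => toPSet_equiv_iff.1 h ▸ hγ, fun h => ⟨α, h, .rfl⟩⟩

theorem ord_eq_iff : eq (ord α) (ord β) p ↔ α = β :=
  ⟨fun h => toPSet_equiv_iff.1 (equiv_of_check_eq h), fun h => h ▸ eq_refl _ _⟩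

theorem ord_mem_iff : mem (ord α) (ord β) p ↔ α < β :=
  ⟨fun h => toPSet_mem_iff.1 (mem_of_check_mem h), fun h => check_mem_check (toPSet_mem_iff.2 h) p⟩

theorem mem_ord_elim [Reg ψ] (h : mem x (ord α) p)
    (H : ∀ r, p ≤ r → ∀ β < α, eq x (ord β) r → ψ r) : ψ p :=
  mem_check_elim h fun r hr Y hY h' => by
    obtain ⟨β, hβ, hY⟩ := Ordinal.mem_toPSet_iff.1 hY
    exact H r hr β hβ (eq_trans h' (check_eq_of_equiv hY r))

theorem ord_sub_iff : sub (ord α) (ord β) p ↔ α ≤ β := by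
  rw [sub_iff]
  constructor
  · refine fun h => le_of_forall_lt fun γ hγ => ?_
    exact ord_mem_iff.1 (h _ p le_rfl (ord_mem_iff.2 hγ))
  · refine fun h z q _ hz => mem_ord_elim hz fun r _ γ hγ h' => ?_
    exact mem_congr_left (eq_symm h') (ord_mem_iff.2 (hγ.trans_le h))

theorem isLimitOrd_ord (h : Order.IsSuccLimit α) : isLimitOrd (ord α) p := by
  refine ⟨allIn_iff.2 fun x q _ hx => mem_ord_elim hx fun r _ β hβ h' => ?_,
    allIn_iff.2 fun x q _ hx => mem_ord_elim hx fun r _ β hβ h' => ?_,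
    ex_intro (ord 0) (ord_mem_iff.2 h.bot_lt),
    allIn_iff.2 fun x q _ hx => mem_ord_elim hx fun r _ β hβ h' => ?_⟩
  · refine sub_iff.2 fun z q hq hz => ?_
    exact sub_iff.1 (ord_sub_iff.2 hβ.le) z q (le_refl q)
      (mem_congr_right (Reg.mono hq h') hz)
  · refine allIn_iff.2 fun y q hq hy => sub_iff.2 fun z q' hq' hz => ?_
    have hx' := Reg.mono (hq.trans hq') h'
    refine mem_congr_right (eq_symm hx') ?_
    refine mem_ord_elim (mem_congr_right hx' (Reg.mono hq' hy)) fun s hs γ hγ hyγ => ?_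
    exact sub_iff.1 (ord_sub_iff.2 hγ.le) z s (le_refl s)
      (mem_congr_right hyγ (Reg.mono hs hz))
  · exact exIn_intro (ord (Order.succ β)) (ord_mem_iff.2 (h.succ_lt hβ))
      (mem_congr_left (eq_symm h') (ord_mem_iff.2 (Order.lt_succ β)))

end Ordinals

end FStmt

/-! ### Names of functions and of sequences -/

namespace FStmt

variable {P : Type v} [Preorder P] {p q : P} {x y z w x' y' z' a b f a' f' : PName.{u, v} P}
  {φ ψ : FStmt P} {Φ Ψ : PName.{u, v} P → FStmt P} [Small.{u} P]

theorem isFun_iff : isFun f a b p ↔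
    (∀ z q, p ≤ q → mem z f q → (exIn a fun x => exIn b fun y => eq z (.opair x y)) q) ∧
    (∀ x q, p ≤ q → mem x a q → (exIn b fun y => mem (.opair x y) f) q) ∧
    (∀ x y y' q, p ≤ q → mem x a q → mem y b q → mem y' b q → mem (.opair x y) f q →
      mem (.opair x y') f q → eq y y' q) := by
  refine and_congr allIn_iff (and_congr allIn_iff ?_)
  simp only [allIn_iff, imp_iff]
  constructor
  · intro h x y y' q hq hx hy hy' h₁ h₂
    exact h x q hq hx y q le_rfl hy y' q le_rfl hy' q le_rfl h₁ q le_rfl h₂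
  · intro h x q hq hx y q₁ hq₁ hy y' q₂ hq₂ hy' q₃ hq₃ h₁ q₄ hq₄ h₂
    have h34 := hq₃.trans hq₄
    have h24 := hq₂.trans h34
    have h14 := hq₁.trans h24
    exact h x y y' q₄ (hq.trans h14) (Reg.mono h14 hx) (Reg.mono h24 hy)
      (Reg.mono h34 hy') (Reg.mono hq₄ h₁) h₂

instance : Reg (isFun f a b) := by unfold isFun; infer_instance

theorem isInj_iff : isInj f a b p ↔ isFun f a b p ∧
    (∀ x x' y q, p ≤ q → mem x a q → mem x' a q → mem y b q → mem (.opair x y) f q →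
      mem (.opair x' y) f q → eq x x' q) := by
  refine and_congr Iff.rfl ?_
  simp only [allIn_iff, imp_iff]
  constructor
  · intro h x x' y q hq hx hx' hy h₁ h₂
    exact h x q hq hx x' q le_rfl hx' y q le_rfl hy q le_rfl h₁ q le_rfl h₂
  · intro h x q hq hx x' q₁ hq₁ hx' y q₂ hq₂ hy q₃ hq₃ h₁ q₄ hq₄ h₂
    have h34 := hq₃.trans hq₄
    have h24 := hq₂.trans h34
    have h14 := hq₁.trans h24
    exact h x x' y q₄ (hq.trans h14) (Reg.mono h14 hx) (Reg.mono h24 hx')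
      (Reg.mono h34 hy) (Reg.mono hq₄ h₁) h₂

instance : Reg (isInj f a b) := by unfold isInj; infer_instance

instance : Reg (isSeq x y) := by unfold isSeq; infer_instance

theorem isFun_congr (hf : eq f f' p) (ha : eq a a' p) (h : isFun f a b p) : isFun f' a' b p := by
  rw [isFun_iff] at h ⊢
  refine ⟨fun z q hq hz => ?_, fun x q hq hx => ?_, fun x y y' q hq hx hy hy' h₁ h₂ => ?_⟩
  · refine exIn_elim (h.1 z q hq (mem_congr_right (eq_symm (Reg.mono hq hf)) hz))
      fun r hr x hx hΦ => exIn_intro x (mem_congr_right (Reg.mono (hq.trans hr) ha) hx) hΦ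
  · refine exIn_elim (h.2.1 x q hq (mem_congr_right (eq_symm (Reg.mono hq ha)) hx))
      fun r hr y hy h' => exIn_intro y hy (mem_congr_right (Reg.mono (hq.trans hr) hf) h')
  · have hf' := eq_symm (Reg.mono hq hf)
    exact h.2.2 x y y' q hq (mem_congr_right (eq_symm (Reg.mono hq ha)) hx) hy hy'
      (mem_congr_right hf' h₁) (mem_congr_right hf' h₂)

theorem mem_of_opair_mem (h : isFun f a b p) (h' : mem (.opair x y) f p) :
    mem x a p ∧ mem y b p := by
  have := (isFun_iff.1 h).1 _ p le_rfl h'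
  exact ⟨exIn_elim this fun r _ x₁ hx₁ h₁ => exIn_elim h₁ fun r' hr' _ _ h₂ =>
      mem_congr_left (eq_symm (left_eq_of_opair_eq h₂)) (Reg.mono hr' hx₁),
    exIn_elim this fun r _ x₁ _ h₁ => exIn_elim h₁ fun r' _ _ hy₁ h₂ =>
      mem_congr_left (eq_symm (right_eq_of_opair_eq h₂)) hy₁⟩

/-! Sequences of the ground model. -/

section Seq

variable {s t : BinSeq.{u}} {ξ α : Ordinal.{u}}

/-- The ordinal `0` or `1`. -/
noncomputable def bit (i : Bool) : Ordinal.{u} := if i then 1 else 0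

theorem bit_injective : Function.Injective bit := by
  intro i j h
  cases i <;> cases j <;> simp [bit] at h ⊢

theorem bit_lt_two (i : Bool) : bit i < 2 := by
  cases i <;> simp [bit]

theorem eq_bit_of_lt_two {β : Ordinal.{u}} (h : β < 2) : ∃ i, β = bit i := by
  rw [← one_add_one_eq_two, ← Order.succ_eq_add_one, Order.lt_succ_iff] at h
  rcases h.lt_or_eq with h | h
  · exact ⟨false, Order.lt_one_iff.1 h⟩
  · exact ⟨true, h⟩

/-- The canonical name of a sequence. -/
noncomputable abbrev seq (s : BinSeq.{u}) : PName.{u, v} P := .check s.toPSet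

/-- The name of the pair of `ξ` and `s ξ`. -/
noncomputable abbrev entry (s : BinSeq.{u}) (ξ : Ordinal.{u}) : PName.{u, v} P :=
  .opair (ord ξ) (ord (bit (s.val ξ)))

theorem mem_seq_elim [Reg ψ] (h : mem z (seq s) p)
    (H : ∀ r, p ≤ r → ∀ ξ < s.len, eq z (entry s ξ) r → ψ r) : ψ p :=
  mem_check_elim h fun r hr _ ⟨i, hi⟩ h' =>
    H r hr _ (Ordinal.ToType.toOrd i).2
      (eq_trans (eq_trans h' (check_eq_of_equiv hi r)) (check_opair_eq _ _ r))

theorem entry_mem_seq (hξ : ξ < s.len) (p : P) : mem (entry s ξ) (seq s) p := by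
  refine mem_congr_left (check_opair_eq _ _ p) (check_mem_check ?_ p)
  refine ⟨Ordinal.ToType.mk ⟨ξ, hξ⟩, ?_⟩
  have e : Ordinal.ToType.toOrd (Ordinal.ToType.mk ⟨ξ, hξ⟩) = ⟨ξ, hξ⟩ :=
    Ordinal.ToType.mk.symm_apply_apply _
  let F : Set.Iio s.len → PSet.{u} := fun a =>
    {{(a : Ordinal.{u}).toPSet}, {(a : Ordinal.{u}).toPSet, (bit (s.val a)).toPSet}}
  change (F ⟨ξ, hξ⟩).Equiv (F (Ordinal.ToType.toOrd (Ordinal.ToType.mk ⟨ξ, hξ⟩)))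
  rw [e]

theorem opair_mem_seq_elim [Reg ψ] (h : mem (.opair x y) (seq s) p)
    (H : ∀ r, p ≤ r → ∀ ξ < s.len, eq x (ord ξ) r → eq y (ord (bit (s.val ξ))) r → ψ r) : ψ p :=
  mem_seq_elim h fun r hr ξ hξ h' =>
    H r hr ξ hξ (left_eq_of_opair_eq h') (right_eq_of_opair_eq h')

theorem lt_len_of_opair_mem_seq (h : mem (.opair (ord ξ) y) (seq s) p) :
    ξ < s.len ∧ eq y (ord (bit (s.val ξ))) p := by
  constructor
  · obtain ⟨r, -, Y, ⟨i, hi⟩, h'⟩ := mem_check_iff.1 h p le_rfl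
    have h₁ := eq_trans (eq_trans h' (check_eq_of_equiv hi r)) (check_opair_eq _ _ r)
    rw [ord_eq_iff.1 (left_eq_of_opair_eq h₁)]
    exact (Ordinal.ToType.toOrd i).2
  · refine opair_mem_seq_elim h fun r _ ξ' _ h₁ h₂ => ?_
    rwa [ord_eq_iff.1 h₁]

theorem isSeq_seq (s : BinSeq.{u}) (p : P) : isSeq (seq s) (ord s.len) p := by
  refine isFun_iff.2 ⟨fun z q _ hz => ?_, fun x q _ hx => ?_, fun x y y' q _ _ _ _ h₁ h₂ => ?_⟩
  · exact mem_seq_elim hz fun r _ ξ hξ h' => exIn_intro (ord ξ) (ord_mem_iff.2 hξ)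
      (exIn_intro (ord (bit (s.val ξ))) (ord_mem_iff.2 (bit_lt_two _)) h')
  · exact mem_ord_elim hx fun r _ ξ hξ h' => exIn_intro (ord (bit (s.val ξ)))
      (ord_mem_iff.2 (bit_lt_two _))
      (mem_congr_left (opair_congr (eq_symm h') (eq_refl _ _)) (entry_mem_seq hξ r))
  · refine opair_mem_seq_elim h₁ fun r hr ξ _ hx hy => ?_
    have := mem_congr_left (opair_congr hx (eq_refl _ _)) (Reg.mono hr h₂)
    exact eq_trans hy (eq_symm (lt_len_of_opair_mem_seq this).2)

theorem eq_len_of_isSeq (h : isSeq (seq s) (ord α) p) : α = s.len := by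
  refine le_antisymm (le_of_forall_lt fun ξ hξ => ?_) (le_of_forall_lt fun ξ hξ => ?_)
  · obtain ⟨r, -, y, -, hy⟩ := (isFun_iff.1 h).2.1 (ord ξ) p le_rfl (ord_mem_iff.2 hξ) p le_rfl
    exact (lt_len_of_opair_mem_seq hy).1
  · exact ord_mem_iff.1 (mem_of_opair_mem h (entry_mem_seq hξ p)).1

theorem seq_sub_iff : sub (seq s) (seq t) p ↔ s ≤ t := by
  rw [sub_iff]
  constructor
  · intro h
    have key : ∀ ξ < s.len, ξ < t.len ∧ s.val ξ = t.val ξ := fun ξ hξ => by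
      have := lt_len_of_opair_mem_seq (h _ p le_rfl (entry_mem_seq hξ p))
      exact ⟨this.1, bit_injective (ord_eq_iff.1 this.2)⟩
    exact ⟨le_of_forall_lt fun ξ hξ => (key ξ hξ).1, fun ξ hξ => (key ξ hξ).2⟩
  · refine fun h z q _ hz => mem_seq_elim hz fun r _ ξ hξ h' => ?_
    refine mem_congr_left (eq_symm h') ?_
    have := entry_mem_seq (hξ.trans_le h.1) r
    rwa [entry, ← h.2 ξ hξ] at this

theorem seq_eq_iff : eq (seq s) (seq t) p ↔ s = t := by
  refine ⟨fun h => le_antisymm (seq_sub_iff (p := p).1 ?_) (seq_sub_iff (p := p).1 ?_),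
    fun h => h ▸ eq_refl _ _⟩
  · exact sub_iff.2 fun z q hq hz => mem_congr_right (Reg.mono hq h) hz
  · exact sub_iff.2 fun z q hq hz => mem_congr_right (eq_symm (Reg.mono hq h)) hz

theorem nil_eq_empty (p : P) : eq (seq .nil) (.check ∅) p := by
  refine check_eq_of_equiv (PSet.Mem.ext fun w => ?_) p
  refine ⟨fun ⟨i, _⟩ => absurd (Set.mem_Iio.1 (Ordinal.ToType.toOrd i).2) not_lt_zero,
    fun h => absurd h (PSet.notMem_empty w)⟩

/-- A subset of a sequence which is a function on `α` is the restriction to `α`. -/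
theorem eq_restrict_of_sub (hx : isSeq x (ord α) p) (h : sub x (seq t) p) :
    eq x (seq (t.restrict α)) p := by
  have hval : ∀ ξ < α, entry (P := P) t ξ = entry (t.restrict α) ξ := fun ξ hξ => by
    rw [entry, entry, BinSeq.restrict_val hξ]
  refine eq_of_forall fun z q hq => ⟨fun hz => ?_, fun hz => ?_⟩
  · refine mem_seq_elim (sub_iff.1 h z q hq hz) fun r hr ξ hξ h' => ?_
    have h₁ := mem_of_opair_mem (Reg.mono (hq.trans hr) hx)
      (mem_congr_left h' (Reg.mono hr hz))
    have hξα := ord_mem_iff.1 h₁.1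
    refine mem_congr_left (eq_symm h') ?_
    rw [hval ξ hξα]
    exact entry_mem_seq (lt_min hξ hξα) r
  · refine mem_seq_elim hz fun r hr ξ hξ h' => ?_
    have hξα := hξ.trans_le (min_le_right _ _)
    rw [← hval ξ hξα] at h'
    refine exIn_elim ((isFun_iff.1 hx).2.1 (ord ξ) r (hq.trans hr) (ord_mem_iff.2 hξα))
      fun r' hr' y _ hy => ?_
    have := sub_iff.1 h _ r' (hq.trans (hr.trans hr')) hy
    exact mem_congr_left (eq_trans (opair_congr (eq_refl _ _) (lt_len_of_opair_mem_seq this).2)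
      (eq_symm (Reg.mono hr' h'))) hy

theorem mem_snoc_iff {i : Bool} : mem z (seq (s.snoc i)) p ↔
    (mem z (seq s) ∨ᶠ eq z (.opair (ord s.len) (ord (bit i)))) p := by
  have hval : ∀ ξ < s.len, (s.snoc i).val ξ = s.val ξ := fun ξ hξ => if_neg hξ.ne
  have hlast : (s.snoc i).val s.len = i := if_pos rfl
  constructor
  · refine fun hz => mem_seq_elim hz fun r _ ξ hξ h => ?_
    rcases (Order.lt_succ_iff.1 hξ).lt_or_eq with hlt | rfl
    · rw [entry, hval ξ hlt] at h
      exact or_inl (mem_congr_left (eq_symm h) (entry_mem_seq hlt r))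
    · rw [entry, hlast] at h
      exact or_inr h
  · refine fun hz => or_elim hz (fun r _ h => ?_) fun r _ h => ?_
    · exact sub_iff.1 (seq_sub_iff.2 (s.le_snoc i)) z r (le_refl r) h
    · have := entry_mem_seq (s := s.snoc i) (Order.lt_succ s.len) r
      rw [entry, hlast] at this
      exact mem_congr_left (eq_symm h) this

end Seq

end FStmt

/-! ### The generic tree is a Souslin tree -/

namespace FStmt

open Cardinal

section Generic

variable {lam : Cardinal.{u}} {p q : TreeCond lam} {x y z A : PName.{u, u + 1} (TreeCond lam)}
  {ψ : FStmt (TreeCond lam)} {s t : BinSeq.{u}}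

theorem mem_genericTree_elim [Reg ψ] (h : mem x (genericTree lam) p)
    (H : ∀ r, p ≤ r → ∀ s ∈ r.carrier, eq x (seq s) r → ψ r) : ψ p :=
  Reg.dense fun q hq => by
    obtain ⟨r, hr, ⟨⟨T, s⟩, hs⟩, hT, h'⟩ := mem_ofSmall.1 h q hq
    exact ⟨r, hr, H r (hq.trans hr) s (TreeCond.mem_of_le hT hs) h'⟩

theorem seq_mem_genericTree (h : s ∈ p.carrier) : mem (seq s) (genericTree lam) p :=
  mem_ofSmall_self (ι := {x : TreeCond lam × BinSeq.{u} // x.2 ∈ x.1.carrier})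
    (elt := fun x => PName.check x.1.2.toPSet) ⟨(p, s), h⟩ le_rfl

theorem exists_of_mem_genericTree (h : mem x (genericTree lam) p) :
    ∃ r, p ≤ r ∧ ∃ s ∈ r.carrier, eq x (seq s) r := by
  obtain ⟨r, hr, ⟨⟨T, s⟩, hs⟩, hT, h'⟩ := mem_ofSmall.1 h p le_rfl
  exact ⟨r, hr, s, TreeCond.mem_of_le hT hs, h'⟩

theorem exists_mem_of_seq_mem_genericTree (h : mem (seq s) (genericTree lam) p) :
    ∃ r, p ≤ r ∧ s ∈ r.carrier := by
  obtain ⟨r, hr, t, ht, h⟩ := exists_of_mem_genericTree h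
  exact ⟨r, hr, seq_eq_iff.1 h ▸ ht⟩

theorem len_lt_ord (h : s ∈ p.carrier) : s.len < lam.ord :=
  (p.isTree.len_lt s h).trans p.height_lt

/-- Densely, every name involved equals that of a ground model sequence or ordinal, and each clause
becomes a property of the tree of a condition. Only extensions of prescribed length require taller
conditions, supplied by `hext`. -/
theorem isOrdTree_genericTree (hlam : lam.IsInaccessible)
    (hext : ∀ p : TreeCond lam, ∀ γ < lam.ord, ∃ q, p ≤ q ∧ γ < q.height) (p : TreeCond lam) :
    isOrdTree (genericTree lam) (ord lam.ord) p := by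
  refine ⟨isLimitOrd_ord (isSuccLimit_ord hlam.aleph0_lt.le), ?_, ?_, ?_, ?_, ?_⟩
  · refine allIn_iff.2 fun x q _ hx => mem_genericTree_elim hx fun r _ s hs h => ?_
    exact exIn_intro (ord s.len) (ord_mem_iff.2 (len_lt_ord hs))
      (isFun_congr (eq_symm h) (eq_refl _ _) (isSeq_seq s r))
  · exact mem_congr_left (nil_eq_empty p) (seq_mem_genericTree p.isTree.nil_mem)
  · refine allIn_iff.2 fun x q _ hx => mem_genericTree_elim hx fun r _ t ht h => ?_
    refine allIn_iff.2 fun a r₁ hr₁ ha => mem_ord_elim ha fun r₂ hr₂ α _ h' => ?_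
    refine fun z => imp_iff.2 fun r₃ hr₃ hz => imp_iff.2 fun r₄ hr₄ hzx => ?_
    have h24 := hr₃.trans hr₄
    have h04 := hr₁.trans (hr₂.trans h24)
    have heq := eq_restrict_of_sub
      (isFun_congr (eq_refl _ _) (Reg.mono h24 h') (Reg.mono (φ := isSeq z a) hr₄ hz))
      (sub_congr (eq_refl _ _) (Reg.mono h04 h) hzx)
    exact mem_congr_left (eq_symm heq) (seq_mem_genericTree
      (TreeCond.down_mem (TreeCond.mem_of_le h04 ht) (t.restrict_le α)))
  · refine allIn_iff.2 fun x q _ hx => mem_genericTree_elim hx fun r _ s hs h => ?_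
    refine allIn_iff.2 fun a r₁ hr₁ ha => mem_ord_elim ha fun r₂ hr₂ α _ h' => ?_
    refine imp_iff.2 fun r₃ hr₃ hxa => allIn_iff.2 fun i r₄ hr₄ hi =>
      mem_ord_elim hi fun r₅ hr₅ β hβ hiβ => ?_
    obtain ⟨i, rfl⟩ := eq_bit_of_lt_two hβ
    have h35 := hr₄.trans hr₅
    have h25 := hr₃.trans h35
    have h05 := hr₁.trans (hr₂.trans h25)
    have hα : α = s.len := eq_len_of_isSeq (isFun_congr (Reg.mono h05 h) (Reg.mono h25 h')
      (Reg.mono (φ := isSeq x a) h35 hxa))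
    subst hα
    refine exIn_intro (seq (s.snoc i)) (seq_mem_genericTree
      (r₅.isTree.snoc_mem s (TreeCond.mem_of_le h05 hs) i)) fun z => iff_iff.2 fun r₆ hr₆ => ?_
    have hx₆ := Reg.mono (h05.trans hr₆) h
    have hop := opair_congr (Reg.mono (h25.trans hr₆) h') (Reg.mono hr₆ hiβ)
    rw [mem_snoc_iff]
    constructor
    · exact fun hz => or_elim hz
        (fun r₇ hr₇ h₇ => or_inl (mem_congr_right (eq_symm (Reg.mono hr₇ hx₆)) h₇))
        fun r₇ hr₇ h₇ => or_inr (eq_trans h₇ (eq_symm (Reg.mono hr₇ hop)))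
    · exact fun hz => or_elim hz
        (fun r₇ hr₇ h₇ => or_inl (mem_congr_right (Reg.mono hr₇ hx₆) h₇))
        fun r₇ hr₇ h₇ => or_inr (eq_trans h₇ (Reg.mono hr₇ hop))
  · refine allIn_iff.2 fun x q _ hx => mem_genericTree_elim hx fun r _ s hs h => ?_
    refine allIn_iff.2 fun a r₁ hr₁ ha => mem_ord_elim ha fun r₂ hr₂ α _ h' => ?_
    refine imp_iff.2 fun r₃ hr₃ hxa => allIn_iff.2 fun b r₄ hr₄ hb =>
      mem_ord_elim hb fun r₅ hr₅ β hβ hbβ => imp_iff.2 fun r₆ hr₆ hab => ?_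
    have h36 := hr₄.trans (hr₅.trans hr₆)
    have h26 := hr₃.trans h36
    have h06 := hr₁.trans (hr₂.trans h26)
    have hα : α = s.len := eq_len_of_isSeq (isFun_congr (Reg.mono h06 h) (Reg.mono h26 h')
      (Reg.mono (φ := isSeq x a) h36 hxa))
    subst hα
    have hsβ : s.len ≤ β := ord_sub_iff.1 (sub_congr (Reg.mono h26 h') (Reg.mono hr₆ hbβ) hab)
    refine Reg.dense fun r₇ hr₇ => ?_
    obtain ⟨r₈, hr₈, hlt⟩ := hext r₇ β hβ
    have h68 := hr₇.trans hr₈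
    obtain ⟨t, ht, hst, rfl⟩ := r₈.isTree.exists_ext s (TreeCond.mem_of_le (h06.trans h68) hs)
      β hlt hsβ
    refine ⟨r₈, hr₈, exIn_intro (seq t) (seq_mem_genericTree ht) ⟨?_, ?_⟩⟩
    · exact sub_congr (eq_symm (Reg.mono (h06.trans h68) h)) (eq_refl _ _) (seq_sub_iff.2 hst)
    · exact isFun_congr (eq_refl _ _) (eq_symm (Reg.mono (hr₆.trans h68) hbβ)) (isSeq_seq t r₈)

/-- If fewer than `lam` dense open sets can be met, then `lam` remains a cardinal. -/
theorem isLimitCard_ord (hlam : lam.IsInaccessible)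
    (hdist : ∀ (p : TreeCond lam) {ι : Type u} (_ : #ι < lam) (D : ι → TreeCond lam → Prop),
      (∀ a T T', T ≤ T' → D a T → D a T') → (∀ a T, p ≤ T → ∃ T', T ≤ T' ∧ D a T') →
      ∃ q, p ≤ q ∧ ∀ a, D a q) (p : TreeCond lam) :
    isLimitCard (ord lam.ord) p := by
  refine ⟨isLimitOrd_ord (isSuccLimit_ord hlam.aleph0_lt.le), allIn_iff.2 fun b q _ hb =>
    mem_ord_elim hb fun r hr β hβ hbβ => fun r₁ hr₁ hex => ?_⟩
  obtain ⟨r₂, hr₂, f, hf⟩ := hex r₁ le_rfl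
  have hbβ' := Reg.mono (hr₁.trans hr₂) hbβ
  obtain ⟨hfun, hinj⟩ := isInj_iff.1 hf
  -- Deciding `f` on the successor cardinal of `β.card` already contradicts injectivity in the
  -- ground model, and takes fewer than `lam` dense sets.
  have hκ : Order.succ β.card < lam := hlam.isSuccLimit.succ_lt (lt_ord.1 hβ)
  have hκlt : ∀ a : (Order.succ β.card).ord.ToType,
      (Ordinal.ToType.toOrd a : Ordinal.{u}) < lam.ord := fun a =>
    (Set.mem_Iio.1 (Ordinal.ToType.toOrd a).2).trans (ord_lt_ord.2 hκ)
  obtain ⟨r₃, hr₃, hD⟩ := hdist r₂ (ι := (Order.succ β.card).ord.ToType)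
    (by rwa [mk_toType, card_ord])
    (fun a T => ∃ γ < β, mem (.opair (ord (Ordinal.ToType.toOrd a : Ordinal.{u})) (ord γ)) f T)
    (fun a T T' h ⟨γ, hγ, h'⟩ => ⟨γ, hγ, Reg.mono h h'⟩)
    (fun a T hT => by
      obtain ⟨T₁, hT₁, y, hy, h⟩ := (isFun_iff.1 hfun).2.1
        (ord (Ordinal.ToType.toOrd a : Ordinal.{u})) T hT (ord_mem_iff.2 (hκlt a)) T le_rfl
      obtain ⟨T₂, hT₂, Y, hY, hyY⟩ := mem_check_iff.1
        (mem_congr_right (Reg.mono (hT.trans hT₁) hbβ') hy) T₁ le_rfl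
      obtain ⟨γ, hγ, hYγ⟩ := Ordinal.mem_toPSet_iff.1 hY
      exact ⟨T₂, hT₁.trans hT₂, γ, hγ, mem_congr_left (opair_congr (eq_refl _ _)
        (eq_trans hyY (check_eq_of_equiv hYγ _))) (Reg.mono hT₂ h)⟩)
  choose g hg hg' using hD
  have hginj : Function.Injective fun a => Ordinal.ToType.mk ⟨g a, hg a⟩ := by
    intro a a' h
    have hgg : g a = g a' := Subtype.ext_iff.1 (Ordinal.ToType.mk.injective h)
    have h₁ := hg' a'
    rw [← hgg] at h₁
    have := ord_eq_iff.1 (hinj _ _ _ r₃ hr₃ (ord_mem_iff.2 (hκlt a)) (ord_mem_iff.2 (hκlt a'))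
      (mem_congr_right (eq_symm (Reg.mono hr₃ hbβ')) (ord_mem_iff.2 (hg a))) (hg' a) h₁)
    exact Ordinal.ToType.mk.symm.injective (Subtype.ext this)
  have := mk_le_of_injective hginj
  rw [mk_toType, mk_toType, card_ord] at this
  exact (Order.lt_succ β.card).not_ge this

/-- `T` decides in what way `s` is related to the elements of `A`: some element of `A` is forced to
lie below `s`, or all elements of `A` are forced to be incomparable with `s`. -/
def Decides (A : PName.{u, u + 1} (TreeCond lam)) (T : TreeCond lam) (s : BinSeq.{u}) : Prop :=
  (∃ a, a ≤ s ∧ mem (seq a) A T) ∨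
    ∀ a T', T ≤ T' → mem (seq a) A T' → ¬ a ≤ s ∧ ¬ s ≤ a

theorem Decides.mono {T T' : TreeCond lam} (h : T ≤ T') (hs : Decides A T s) :
    Decides A T' s := by
  rcases hs with ⟨a, ha, h'⟩ | hs
  · exact Or.inl ⟨a, ha, Reg.mono h h'⟩
  · exact Or.inr fun a T'' hT => hs a T'' (h.trans hT)

/-- If a stronger condition puts some `a` comparable with `s` into `A`, strengthen it until `a` is a
node; the longer of `a` and `s` then decides. Otherwise `s` itself decides negatively. -/
theorem exists_decides {T : TreeCond lam} (hA : sub A (genericTree lam) T) (hs : s ∈ T.carrier) :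
    ∃ T', T ≤ T' ∧ ∃ t ∈ T'.carrier, s ≤ t ∧ Decides A T' t := by
  by_cases h : ∃ a T', T ≤ T' ∧ mem (seq a) A T' ∧ (a ≤ s ∨ s ≤ a)
  · obtain ⟨a, T', hT, ha, h'⟩ := h
    obtain ⟨T'', hT', haT⟩ := exists_mem_of_seq_mem_genericTree (sub_iff.1 hA _ T' hT ha)
    have ha' := Reg.mono hT' ha
    refine ⟨T'', hT.trans hT', ?_⟩
    rcases h' with h' | h'
    · exact ⟨s, TreeCond.mem_of_le (hT.trans hT') hs, le_rfl, Or.inl ⟨a, h', ha'⟩⟩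
    · exact ⟨a, haT, h', Or.inl ⟨a, le_rfl, ha'⟩⟩
  · push Not at h
    exact ⟨T, le_rfl, s, hs, le_rfl, Or.inr fun a T' hT ha => h a T' hT ha⟩

/-- If all nodes at level `μ` lie above nodes at which `A` is decided, then the elements of the
antichain `A` have length less than `μ`. -/
theorem exists_len_lt_of_decides {μ : Ordinal.{u}} (hA : isAntichain A (genericTree lam) q)
    (hμ : μ < q.height)
    (h : ∀ s ∈ q.carrier, s.len = μ → ∃ t, t ≤ s ∧ t.len < μ ∧ Decides A q t)
    (hq : q ≤ p) (hx : mem x A p) :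
    ∃ r, p ≤ r ∧ ∃ s : BinSeq.{u}, s.len < μ ∧ eq x (seq s) r := by
  obtain ⟨r, hr, s, hs, hxs⟩ := exists_of_mem_genericTree (sub_iff.1 hA.1 x p hq hx)
  refine ⟨r, hr, s, lt_of_not_ge fun hl => ?_, hxs⟩
  have hqr := hq.trans hr
  have hsA := mem_congr_left hxs (Reg.mono hr hx)
  have hlen : (s.restrict μ).len = μ := BinSeq.restrict_len_of_le hl
  obtain ⟨t, hts, htμ, ⟨a, hat, ha⟩ | hno⟩ := h (s.restrict μ)
    (TreeCond.mem_of_le_of_len_lt hqr (TreeCond.down_mem hs (s.restrict_le μ))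
      (hlen.trans_lt hμ)) hlen
  -- Both `a` and `s` are in the antichain and comparable, hence equal, although `a` is shorter than
  -- `μ` and `s` is not.
  · have has : a ≤ s := hat.trans (hts.trans (s.restrict_le μ))
    have h₁ := allIn_iff.1 (allIn_iff.1 hA.2 (seq a) q le_rfl ha) (seq s) r hqr hsA
    have := seq_eq_iff.1 (imp_iff.1 h₁ r le_rfl (seq_sub_iff.2 has))
    rw [this] at hat
    exact ((BinSeq.len_mono hat).trans_lt htμ).not_ge hl
  · exact (hno s r hqr hsA).2 (hts.trans (s.restrict_le μ))

/-- A name for the restriction of a ground model function to the set `A`. -/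
noncomputable def graphName (A : PName.{u, u + 1} (TreeCond lam)) (μ : Ordinal.{u})
    (e : BinSeq.{u} → Ordinal.{u}) : PName.{u, u + 1} (TreeCond lam) :=
  haveI := small_binSeq_lt μ
  .ofSmall (ι := {x : TreeCond lam × {s : BinSeq.{u} // s.len < μ} // mem (seq x.2.1) A x.1})
    (fun x => .opair (seq x.1.2.1) (ord (e x.1.2.1))) fun x => x.1.1

theorem mem_graphName_elim [Reg ψ] {μ : Ordinal.{u}} {e : BinSeq.{u} → Ordinal.{u}}
    (hz : mem z (graphName A μ e) p) (H : ∀ r, p ≤ r → ∀ s : BinSeq.{u}, s.len < μ →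
      mem (seq s) A r → eq z (.opair (seq s) (ord (e s))) r → ψ r) : ψ p :=
  Reg.dense fun q hq => by
    have := small_binSeq_lt μ
    obtain ⟨r, hr, ⟨⟨T, s, hs⟩, hA⟩, hT, h⟩ := mem_ofSmall.1 hz q hq
    exact ⟨r, hr, H r (hq.trans hr) s hs (Reg.mono hT hA) h⟩

theorem opair_mem_graphName {μ : Ordinal.{u}} {e : BinSeq.{u} → Ordinal.{u}} (hs : s.len < μ)
    (h : mem (seq s) A p) : mem (.opair (seq s) (ord (e s))) (graphName A μ e) p := by
  have := small_binSeq_lt μ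
  exact mem_ofSmall_self
    (ι := {x : TreeCond lam × {s : BinSeq.{u} // s.len < μ} // mem (seq x.2.1) A x.1})
    (elt := fun x => .opair (seq x.1.2.1) (ord (e x.1.2.1))) (cond := fun x => x.1.1)
    ⟨(p, ⟨s, hs⟩), h⟩ le_rfl

/-- A ground model injection of all sequences shorter than `μ` into a cardinal `κ < lam`, restricted
to `A`, is the required injection. -/
theorem cardLt_of_forall_len_lt (hlam : lam.IsInaccessible) {μ : Ordinal.{u}} (hμ : μ < lam.ord)
    (h : ∀ (x : PName.{u, u + 1} (TreeCond lam)) (r : TreeCond lam), p ≤ r → mem x A r →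
      ∃ r', r ≤ r' ∧ ∃ s : BinSeq.{u}, s.len < μ ∧ eq x (seq s) r') :
    cardLt A (ord lam.ord) p := by
  have := small_binSeq_lt μ
  set κ := #(Shrink.{u} {s : BinSeq.{u} // s.len < μ}) with hκ
  obtain ⟨i⟩ : Nonempty (Shrink.{u} {s : BinSeq.{u} // s.len < μ} ≃ κ.ord.ToType) := by
    rw [← Cardinal.eq, mk_toType, card_ord]
  classical
  let e : BinSeq.{u} → Ordinal.{u} := fun s =>
    if hs : s.len < μ then Ordinal.ToType.toOrd (i (equivShrink _ ⟨s, hs⟩)) else 0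
  have he : ∀ s : BinSeq.{u}, s.len < μ → e s < κ.ord := fun s hs => by
    simp only [e, dif_pos hs]
    exact (Ordinal.ToType.toOrd (i (equivShrink _ ⟨s, hs⟩))).2
  have hinj : ∀ s t : BinSeq.{u}, s.len < μ → t.len < μ → e s = e t → s = t := fun s t hs ht h => by
    simp only [e, dif_pos hs, dif_pos ht] at h
    simpa using Subtype.ext h
  refine exIn_intro (ord κ.ord) (ord_mem_iff.2 (ord_lt_ord.2 (mk_binSeq_lt hlam hμ)))
    (ex_intro (graphName A μ e) (isInj_iff.2 ⟨isFun_iff.2 ⟨fun z q _ hz => ?_,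
      fun x q hq hx => ?_, fun x y y' q _ _ _ _ h₁ h₂ => ?_⟩, fun x x' y q _ _ _ _ h₁ h₂ => ?_⟩))
  · exact mem_graphName_elim hz fun r _ s hs hA hz' => exIn_intro (seq s) hA
      (exIn_intro (ord (e s)) (ord_mem_iff.2 (he s hs)) hz')
  · refine Reg.dense fun q₁ hq₁ => ?_
    obtain ⟨r, hr, s, hs, hxs⟩ := h x q₁ (hq.trans hq₁) (Reg.mono hq₁ hx)
    refine ⟨r, hr, exIn_intro (ord (e s)) (ord_mem_iff.2 (he s hs)) ?_⟩
    exact mem_congr_left (opair_congr (eq_symm hxs) (eq_refl _ _))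
      (opair_mem_graphName hs (mem_congr_left hxs (Reg.mono (hq₁.trans hr) hx)))
  · refine mem_graphName_elim h₁ fun r hr s _ _ h₃ => mem_graphName_elim (Reg.mono hr h₂)
      fun r' hr' t _ _ h₄ => ?_
    have h₃' := Reg.mono hr' h₃
    have hst := seq_eq_iff.1 (eq_trans (eq_symm (left_eq_of_opair_eq h₃'))
      (left_eq_of_opair_eq h₄))
    subst hst
    exact eq_trans (right_eq_of_opair_eq h₃') (eq_symm (right_eq_of_opair_eq h₄))
  · refine mem_graphName_elim h₁ fun r hr s hs _ h₃ => mem_graphName_elim (Reg.mono hr h₂)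
      fun r' hr' t ht _ h₄ => ?_
    have h₃' := Reg.mono hr' h₃
    have hst := hinj s t hs ht (ord_eq_iff.1 (eq_trans (eq_symm (right_eq_of_opair_eq h₃'))
      (right_eq_of_opair_eq h₄)))
    subst hst
    exact eq_trans (left_eq_of_opair_eq h₃') (eq_symm (left_eq_of_opair_eq h₄))

instance : Reg (cardLt x y) := by unfold cardLt; infer_instance

instance : Reg (isAntichain x y) := by unfold isAntichain; infer_instance

end Generic

end FStmt

theorem theorem1p6 (lam : Cardinal.{u}) (S : Set Cardinal.{u}) (S₀ : Set Ordinal.{u})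
    (hlam : IsMahloCardinal lam)
    (hS : ∀ μ ∈ S, μ < lam ∧ μ.IsInaccessible)
    (hS_stat : StationaryIn lam.ord (Cardinal.ord '' S))
    (hS₀ : ∀ δ ∈ S₀, δ < lam.ord ∧ Order.IsSuccLimit δ)
    (hdiamond : ∀ μ ∈ S, Diamond S₀ μ.ord) :
    FStmt.Forced (FStmt.isSouslinTree (genericTree lam) (PName.check lam.ord.toPSet)) := by
  open FStmt in
  have hin := hlam.1
  refine fun p => ⟨isLimitCard_ord hin (fun p ι hι D h₁ h₂ => ?_) p,
    isOrdTree_genericTree hin (fun p γ hγ => exists_lt_height hin hS hS_stat p hγ) p,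
    fun A => imp_iff.2 fun q _ hA => Reg.dense fun q₁ hq₁ => ?_⟩
  · obtain ⟨q, hq, -, h⟩ := exists_forall_of_dense hin hS hS_stat p p.height_lt hι D h₁ h₂
    exact ⟨q, hq, h⟩
  · obtain ⟨r, hr, μ, hμ, h⟩ := exists_sealed hin hS hS_stat hS₀ hdiamond (Decides A)
      (fun _ _ _ h => Decides.mono h) q₁
      fun T hT s hs => exists_decides (Reg.mono (hq₁.trans hT) hA.1) hs
    have hA' := Reg.mono (hq₁.trans hr) hA
    exact ⟨r, hr, cardLt_of_forall_len_lt hin (hμ.trans r.height_lt) fun x r₁ hr₁ hx =>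
      exists_len_lt_of_decides hA' hμ h hr₁ hx⟩
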